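/- Let $V$ be a finite-dimensional complex vector space with a nondegenerate hermitian form $h:V\times V\to\mathbb{C}$ (not necessarily definite), linear in the first variable and with $h(v,w)=\overline{h(w,v)}$ for all $v,w\in V$. Let $U(V,h)=\{g\in GL_{\mathbb{C}}(V): h(gv,gw)=h(v,w)\ \forall v,w\in V\}$ and let $\langle v\mid w\rangle=\operatorname{Re}h(v,w)$. Let $r\ge 0$ be an integer and let $U(V,h)$ act diagonally on the real tensor power $\otimes_{\mathbb{R}}^rV$. Let $\operatorname{End}_{U(V,h)}(\otimes_{\mathbb{R}}^rV)$ be the real algebra of all $\mathbb{R}$-linear endomorphisms of $\otimes_{\mathbb{R}}^rV$ that commute with this action. Let $(e_a)_a$ be any basis of $V$ as a real vector space, and let $(f_a)_a$ be its dual basis relative to $\langle\,\cdot\mid\cdot\,\rangle$, so that $\langle e_a\mid f_b\rangle=\delta_{ab}$. Consider the following $\mathbb{R}$-linear endomorphisms of $\otimes_{\mathbb{R}}^rV$: - $\rho(\sigma): v_1\otimes\cdots\otimes v_r\mapsto v_{\sigma(1)}\otimes\cdots\otimes v_{\sigma(r)}$, for $\sigma$ in the symmetric group $S_r$; - $J_l: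 v_1\otimes\cdots\otimes v_r\mapsto v_1\otimes\cdots\otimes v_{l-1}\otimes i\,v_l\otimes v_{l+1}\otimes\cdots\otimes v_r$, for $1\le l\le r$; - $c_{pq}: v_1\otimes\cdots\otimes v_r\mapsto \langle v_p\mid v_q\rangle\sum_a v_1\otimes\cdots\otimes v_{p-1}\otimes e_a\otimes v_{p+1}\otimes\cdots\otimes v_{q-1}\otimes f_a\otimes v_{q+1}\otimes\cdots\otimes v_r$, for $1\le p<q\le r$. Then $\operatorname{End}_{U(V,h)}(\otimes_{\mathbb{R}}^rV)$ is generated as a real algebra by these maps: $$\operatorname{End}_{U(V,h)}(\otimes_{\mathbb{R}}^rV)=\operatorname{alg}_{\mathbb{R}}\{\rho(\sigma),\,J_l,\,c_{pq} : \sigma\in S_r,\ 1\le l\le r,\ 1\le p<q\le r\}.$$ -/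

import Mathlib

open scoped TensorProduct ComplexConjugate

noncomputable section

namespace UnitaryTensor

variable {V : Type*} [AddCommGroup V] [Module ℂ V]

/-- `h : V × V → ℂ`, linear in the first and conjugate-linear in the second variable, is a
hermitian form: `h(v, w)` is the complex conjugate of `h(w, v)`. -/
def IsHermitian (h : V →ₗ[ℂ] V →ₗ⋆[ℂ] ℂ) : Prop :=
  ∀ v w : V, h v w = conj (h w v)

/-- The unitary group `U(V, h) = {g ∈ GL_ℂ(V) : h(g v, g w) = h(v, w) for all v, w}`. -/
def unitaryGroup (h : V →ₗ[ℂ] V →ₗ⋆[ℂ] ℂ) : Subgroup (V ≃ₗ[ℂ] V) where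
  carrier := {g | ∀ v w : V, h (g v) (g w) = h v w}
  one_mem' := fun _ _ => rfl
  mul_mem' := fun {a b} ha hb v w => (ha (b v) (b w)).trans (hb v w)
  inv_mem' := fun {a} ha v w => by
    have key := ha (a⁻¹ v) (a⁻¹ w)
    have e : ∀ x : V, a (a⁻¹ x) = x := fun x => a.apply_symm_apply x
    rw [e, e] at key
    exact key.symm

/-- The real bilinear form `⟨v | w⟩ = Re h(v, w)`. -/
def realForm (h : V →ₗ[ℂ] V →ₗ⋆[ℂ] ℂ) : LinearMap.BilinForm ℝ V :=
  LinearMap.mk₂ ℝ (fun v w => (h v w).re)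
    (fun v v' w => by simp)
    (fun c v w => by
      rw [← Complex.coe_smul c v]
      simp)
    (fun v w w' => by simp)
    (fun c v w => by
      rw [← Complex.coe_smul c w, map_smulₛₗ]
      simp)

theorem realForm_apply (h : V →ₗ[ℂ] V →ₗ⋆[ℂ] ℂ) (v w : V) :
    realForm h v w = (h v w).re := rfl

theorem realForm_nondegenerate {h : V →ₗ[ℂ] V →ₗ⋆[ℂ] ℂ} (hn : h.Nondegenerate) :
    (realForm h).Nondegenerate := by
  constructor
  · intro v hv
    refine hn.1 v fun w => Complex.ext (hv w) ?_
    have := hv (Complex.I • w)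
    simpa [realForm_apply] using this
  · intro w hw
    refine hn.2 w fun v => Complex.ext (hw v) ?_
    have := hw (Complex.I • v)
    simpa [realForm_apply] using this

/-- Multiplication by `i`, as a real linear endomorphism of `V`. -/
def J : V →ₗ[ℝ] V where
  toFun v := Complex.I • v
  map_add' := smul_add _
  map_smul' _ _ := smul_comm _ _ _

variable (V) in
/-- The `r`-th tensor power of `V` over the real numbers. -/
abbrev RealTensorPower (r : ℕ) : Type _ := ⨂[ℝ] _ : Fin r, V

/-- The diagonal action `v₁ ⊗ ⋯ ⊗ v_r ↦ g v₁ ⊗ ⋯ ⊗ g v_r` of `g ∈ GL_ℂ(V)`. -/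
def diagonalAction (r : ℕ) (g : V ≃ₗ[ℂ] V) : Module.End ℝ (RealTensorPower V r) :=
  PiTensorProduct.map fun _ => (g : V →ₗ[ℂ] V).restrictScalars ℝ

/-- The centralizer algebra `End_{U(V,h)}(⊗_ℝ^r V)`: the real endomorphisms of the tensor power
which commute with the action of every element of `U(V, h)`. -/
def centralizerAlgebra (h : V →ₗ[ℂ] V →ₗ⋆[ℂ] ℂ) (r : ℕ) :
    Subalgebra ℝ (Module.End ℝ (RealTensorPower V r)) :=
  Subalgebra.centralizer ℝ (diagonalAction r '' (unitaryGroup h : Set (V ≃ₗ[ℂ] V)))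

/-- `ρ(σ) : v₁ ⊗ ⋯ ⊗ v_r ↦ v_{σ(1)} ⊗ ⋯ ⊗ v_{σ(r)}`. -/
def permMap {r : ℕ} (σ : Equiv.Perm (Fin r)) : Module.End ℝ (RealTensorPower V r) :=
  (PiTensorProduct.reindex ℝ (fun _ : Fin r => V) σ.symm).toLinearMap

theorem permMap_tprod {r : ℕ} (σ : Equiv.Perm (Fin r)) (v : Fin r → V) :
    permMap σ (PiTensorProduct.tprod ℝ v) = PiTensorProduct.tprod ℝ fun i => v (σ i) :=
  PiTensorProduct.reindex_tprod _ _

/-- `J_l : v₁ ⊗ ⋯ ⊗ v_r ↦ v₁ ⊗ ⋯ ⊗ J v_l ⊗ ⋯ ⊗ v_r`. -/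
def slotJ {r : ℕ} (l : Fin r) : Module.End ℝ (RealTensorPower V r) :=
  PiTensorProduct.map (Function.update (fun _ => LinearMap.id) l J)

theorem slotJ_tprod {r : ℕ} (l : Fin r) (v : Fin r → V) :
    slotJ l (PiTensorProduct.tprod ℝ v) =
      PiTensorProduct.tprod ℝ (Function.update v l (Complex.I • v l)) := by
  rw [slotJ, PiTensorProduct.map_tprod]
  congr 1
  funext i
  by_cases hi : i = l
  · subst hi
    simp [J]
  · simp [hi]

/-- For a bilinear form `B` and families `e`, `f` of vectors, the multilinear map sending
`(v₁, …, v_r)` to `B(v_p, v_q) ∑ₐ v₁ ⊗ ⋯ ⊗ e_a ⊗ ⋯ ⊗ f_a ⊗ ⋯ ⊗ v_r`, with `e_a` in slot `p` and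
`f_a` in slot `q`. -/
def contractionMultilinear {r : ℕ} {ι : Type*} [Fintype ι] (B : LinearMap.BilinForm ℝ V)
    (e f : ι → V) (p q : Fin r) (hpq : p ≠ q) :
    MultilinearMap ℝ (fun _ : Fin r => V) (RealTensorPower V r) :=
  MultilinearMap.mk'
    (fun v => B (v p) (v q) • ∑ a : ι,
      PiTensorProduct.tprod ℝ (Function.update (Function.update v p (e a)) q (f a)))
    (by
      intro v i x y
      by_cases hp : i = p
      · subst hp
        simp [hpq.symm, add_smul]
      by_cases hq : i = q
      · subst hq
        simp [hpq, Function.update_comm hpq.symm, add_smul]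
      simp [Ne.symm hp, Ne.symm hq, Function.update_comm hp, Function.update_comm hq,
        Finset.sum_add_distrib])
    (by
      intro v i c x
      by_cases hp : i = p
      · subst hp
        simp [hpq.symm, mul_smul]
      by_cases hq : i = q
      · subst hq
        simp [hpq, Function.update_comm hpq.symm, mul_smul]
      simp [Ne.symm hp, Ne.symm hq, Function.update_comm hp, Function.update_comm hq,
        ← Finset.smul_sum, smul_comm c])

/-- The contraction map `c_{pq}`, computed in a real basis `e` of `V` and the basis `f` dual to `e`
with respect to the nondegenerate form `⟨· | ·⟩ = Re h`:
`v₁ ⊗ ⋯ ⊗ v_r ↦ ⟨v_p | v_q⟩ ∑ₐ v₁ ⊗ ⋯ ⊗ e_a ⊗ ⋯ ⊗ f_a ⊗ ⋯ ⊗ v_r`. -/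
def contraction {h : V →ₗ[ℂ] V →ₗ⋆[ℂ] ℂ} (hn : h.Nondegenerate) {ι : Type*} [Fintype ι]
    [DecidableEq ι] (e : Module.Basis ι ℝ V) {r : ℕ} (p q : Fin r) (hpq : p ≠ q) :
    Module.End ℝ (RealTensorPower V r) :=
  PiTensorProduct.lift (contractionMultilinear (realForm h) e
    ((realForm h).dualBasis (realForm_nondegenerate hn) e) p q hpq)

theorem contraction_tprod {h : V →ₗ[ℂ] V →ₗ⋆[ℂ] ℂ} (hn : h.Nondegenerate) {ι : Type*} [Fintype ι]
    [DecidableEq ι] (e : Module.Basis ι ℝ V) {r : ℕ} (p q : Fin r) (hpq : p ≠ q)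
    (v : Fin r → V) :
    contraction hn e p q hpq (PiTensorProduct.tprod ℝ v) =
      (h (v p) (v q)).re • ∑ a : ι, PiTensorProduct.tprod ℝ
        (Function.update (Function.update v p (e a)) q
          ((realForm h).dualBasis (realForm_nondegenerate hn) e a)) :=
  PiTensorProduct.lift.tprod _

theorem realForm_basis_dualBasis {h : V →ₗ[ℂ] V →ₗ⋆[ℂ] ℂ} (hh : IsHermitian h)
    (hn : h.Nondegenerate) {ι : Type*} [Fintype ι] [DecidableEq ι] (e : Module.Basis ι ℝ V)
    (a b : ι) :
    (h (e a) ((realForm h).dualBasis (realForm_nondegenerate hn) e b)).re =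
      if a = b then 1 else 0 := by
  rw [hh, Complex.conj_re, ← realForm_apply, LinearMap.BilinForm.apply_dualBasis_left]

end UnitaryTensor

end

/-! Through Re h, an endomorphism T of the tensor power is the same as its coefficient ⟨T(v₁ ⊗ ⋯ ⊗
v_r) | w₁ ⊗ ⋯ ⊗ w_r⟩, a real multilinear function of 2r vectors, and T commutes with U(V, h) exactly
when this function is invariant (`mem_centralizerAlgebra_iff`). So the theorem amounts to a first
fundamental theorem for U(V, h) and a translation of the invariants back into products of
generators.

Invariants (`mem_of_unitary_invariant`): with complex values, a real multilinear function splits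
into pieces that are linear or conjugate linear in each slot. Scalars of modulus one kill the pieces
with unequal numbers of the two kinds. A remaining piece is a matrix F on multi-indices, fixed by F
↦ D F D* (tensor powers of D understood) whenever D preserves the Gram matrix H. Then F H⁻¹ commutes
with such D. Cayley transforms supply enough of them: with denominators cleared the relation is
polynomial, so it spreads from skew-adjoint matrices to all matrices. Schur–Weyl duality now makes F
H⁻¹ a combination of permutations, and the piece a combination of products of h over perfect
matchings of the 2r slots.

Translation: h(v, w) = ⟨v | w⟩ + i⟨v | iw⟩, so the J_l reduce products of h to products of Re h
(`prod_hermitian_mem`). A matching of the latter kind is a Brauer diagram, built from permutations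
and contractions (`matchingFun_mem`). Complex scalars do no harm, since real parts can be taken at
the end (`mem_of_coeffFun_mem_coeffSpan`). -/

noncomputable section

namespace UnitaryTensor

/-! ### Double centralizers for finite groups. -/

section

/-- The double centralizer theorem for a finite group acting on a finite dimensional space. -/
theorem mem_span_range_of_commute_centralizer {k G W : Type*} [Field k] [CharZero k] [Group G]
    [Finite G] [AddCommGroup W] [Module k W] [FiniteDimensional k W] (ρ : Representation k G W)
    (Φ : Module.End k W)
    (hΦ : ∀ T : Module.End k W, (∀ g, T * ρ g = ρ g * T) → Φ * T = T * Φ) :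
    Φ ∈ Submodule.span k (Set.range ρ) := by
  -- Maschke: the group order is invertible, so the module is semisimple, as the density theorem
  -- requires.
  have : NeZero (Nat.card G : k) := ⟨Nat.cast_ne_zero.2 Nat.card_pos.ne'⟩
  let R := MonoidAlgebra k G
  let M := ρ.asModule
  let f : Module.End (Module.End R M) M :=
    { toFun := fun m => ρ.asModuleEquiv.symm (Φ (ρ.asModuleEquiv m))
      map_add' := fun x y => by simp
      map_smul' := fun T x => by
        let T' : Module.End k W :=
          (ρ.asModuleEquiv.toLinearMap ∘ₗ (T.restrictScalars k)) ∘ₗ ρ.asModuleEquiv.symm.toLinearMap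
        have hT : ∀ g, T' * ρ g = ρ g * T' := by
          intro g
          ext w
          simp only [T', Module.End.mul_apply, LinearMap.comp_apply, LinearEquiv.coe_coe,
            LinearMap.restrictScalars_apply, Representation.asModuleEquiv_symm_map_rho, map_smul,
            MonoidAlgebra.of_apply]
          rw [Representation.asModuleEquiv_map_smul, Representation.asAlgebraHom_single, one_smul]
        have := congrArg (fun S : Module.End k W => S (ρ.asModuleEquiv x)) (hΦ T' hT)
        simp only [T', Module.End.mul_apply, LinearMap.comp_apply, LinearEquiv.coe_coe,
            LinearMap.restrictScalars_apply, LinearEquiv.symm_apply_apply] at this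
        simp [this] }
  classical
  let b := Module.finBasis k W
  -- Density only gives agreement on a finite set; a basis suffices.
  obtain ⟨a, ha⟩ := jacobson_density f (Finset.univ.image fun i => ρ.asModuleEquiv.symm (b i))
  have hΦa : Φ = ρ.asAlgebraHom a := by
    refine b.ext fun i => ?_
    have := ha (ρ.asModuleEquiv.symm (b i)) (Finset.mem_image_of_mem _ (Finset.mem_univ i))
    have := congrArg ρ.asModuleEquiv this
    rw [Representation.asModuleEquiv_map_smul] at this
    simpa [f] using this
  rw [hΦa]
  clear hΦa ha
  induction a using MonoidAlgebra.induction_linear with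
  | zero => simp
  | add x y hx hy =>
    rw [map_add]
    exact Submodule.add_mem _ hx hy
  | single g c =>
    rw [Representation.asAlgebraHom_single]
    exact Submodule.smul_mem _ _ (Submodule.subset_span ⟨g, rfl⟩)

/-! ### Tensor products of matrices and polarization. -/

section Kronecker

variable {κ n R S : Type*} [Fintype κ] [CommRing R] [CommRing S]

/-- The tensor product of a family of matrices, indexed by multi-indices. -/
def kroneckerPi (X : κ → Matrix n n R) : Matrix (κ → n) (κ → n) R :=
  Matrix.of fun i j => ∏ k, X k (i k) (j k)

theorem kroneckerPi_apply (X : κ → Matrix n n R) (i j : κ → n) :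
    kroneckerPi X i j = ∏ k, X k (i k) (j k) := rfl

theorem kroneckerPi_mul [Fintype n] [DecidableEq κ] (X Y : κ → Matrix n n R) :
    kroneckerPi X * kroneckerPi Y = kroneckerPi fun k => X k * Y k := by
  ext i j
  simp only [Matrix.mul_apply, kroneckerPi_apply, Finset.prod_univ_sum, Fintype.piFinset_univ,
    Finset.prod_mul_distrib]

theorem kroneckerPi_one [DecidableEq n] : kroneckerPi (fun _ : κ => (1 : Matrix n n R)) = 1 := by
  ext i j
  simp only [kroneckerPi_apply, Matrix.one_apply, Finset.prod_ite_zero, Finset.prod_const_one,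
    Finset.mem_univ, true_implies, funext_iff]

theorem kroneckerPi_map (φ : R →+* S) (X : κ → Matrix n n R) :
    (kroneckerPi X).map φ = kroneckerPi fun k => (X k).map φ := by
  ext i j
  simp [kroneckerPi_apply]

/-- Inclusion–exclusion: the sets U avoided by f are the subsets of the complement of its image, and
their alternating sum vanishes unless f is surjective, hence bijective. -/
theorem sum_powerset_compl_sign [DecidableEq κ] (f : κ → κ) :
    (∑ U : Finset κ, if ∀ k, f k ∉ U then (-1 : R) ^ U.card else 0) =
      if Function.Bijective f then 1 else 0 := by
  rw [← Finset.sum_filter]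
  have h1 : (Finset.univ.filter fun U : Finset κ => ∀ k, f k ∉ U) =
      ((Finset.univ.image f)ᶜ).powerset := by
    ext U
    simp only [Finset.mem_filter, Finset.mem_univ, true_and, Finset.mem_powerset,
      Finset.subset_iff, Finset.mem_compl, Finset.mem_image, not_exists]
    exact ⟨fun h x hx k hk => h k (hk ▸ hx), fun h k hk => h hk k rfl⟩
  rw [h1]
  have h2 := congrArg (Int.cast : ℤ → R)
    (Finset.sum_powerset_neg_one_pow_card (x := (Finset.univ.image f)ᶜ))
  push_cast at h2
  rw [h2]
  congr 1
  rw [Finset.compl_eq_empty_iff, ← Finite.surjective_iff_bijective]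
  simp only [Finset.eq_univ_iff_forall, Finset.mem_image, Finset.mem_univ, true_and]
  rfl

/-- Polarization: the symmetrization of a tensor product of matrices is a combination of
tensor powers. -/
theorem sum_perm_kroneckerPi [DecidableEq κ] (X : κ → Matrix n n R) :
    ∑ σ : Equiv.Perm κ, kroneckerPi (fun k => X (σ k)) =
      ∑ U : Finset κ, (-1 : R) ^ U.card • kroneckerPi fun _ : κ => ∑ k ∈ Uᶜ, X k := by
  -- Multilinear expansion: choosing a summand in every factor is choosing a map f with values
  -- outside U. After the sums are exchanged, only bijective f survive.
  have key : ∀ U : Finset κ, kroneckerPi (fun _ : κ => ∑ k ∈ Uᶜ, X k) =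
      ∑ f : κ → κ, if ∀ k, f k ∉ U then kroneckerPi (fun k => X (f k)) else 0 := by
    intro U
    ext i j
    rw [kroneckerPi_apply, ← Finset.sum_filter, Matrix.sum_apply]
    simp only [Matrix.sum_apply, Finset.prod_univ_sum, kroneckerPi_apply]
    refine Finset.sum_congr ?_ fun _ _ => rfl
    ext f
    simp
  simp_rw [key, Finset.smul_sum]
  rw [Finset.sum_comm]
  have : ∀ f : κ → κ, (∑ U : Finset κ, (-1 : R) ^ U.card •
      (if ∀ k, f k ∉ U then kroneckerPi (fun k => X (f k)) else 0)) =
      if Function.Bijective f then kroneckerPi (fun k => X (f k)) else 0 := by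
    intro f
    have := congrArg (· • kroneckerPi (fun k => X (f k))) (sum_powerset_compl_sign (R := R) f)
    simp only [Finset.sum_smul, ite_smul, one_smul, zero_smul] at this
    rw [← this]
    refine Finset.sum_congr rfl fun U _ => ?_
    split_ifs <;> simp
  simp_rw [this]
  rw [← Finset.sum_filter]
  refine Finset.sum_bij (fun σ _ => ⇑σ) (by simp)
    (fun _ _ _ _ h => DFunLike.coe_injective h) (fun f hf => ?_) (fun _ _ => rfl)
  exact ⟨Equiv.ofBijective f (by simpa using hf), by simp, rfl⟩

theorem kroneckerPi_single [DecidableEq n] (i j : κ → n) :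
    kroneckerPi (fun k => Matrix.single (i k) (j k) (1 : R)) = Matrix.single i j 1 := by
  ext a b
  simp only [kroneckerPi_apply, Matrix.single_apply, Finset.prod_ite_zero, Finset.prod_const_one,
    Finset.mem_univ, true_implies, funext_iff, ← forall_and]

end Kronecker

/-! ### Schur–Weyl duality. -/

section SchurWeyl

variable {κ n 𝕜 : Type*} [Field 𝕜]

variable (κ n 𝕜) in
/-- The permutation representation on functions of a multi-index. -/
def multiIndexRep : Representation 𝕜 (Equiv.Perm κ) ((κ → n) → 𝕜) where
  toFun σ := LinearMap.funLeft 𝕜 𝕜 fun i => i ∘ σ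
  map_one' := rfl
  map_mul' _ _ := rfl

theorem multiIndexRep_apply (σ : Equiv.Perm κ) (v : (κ → n) → 𝕜) (i : κ → n) :
    multiIndexRep κ n 𝕜 σ v i = v (i ∘ σ) := rfl

variable [Fintype κ] [DecidableEq κ] [Fintype n] [DecidableEq n]

/-- A matrix commuting with all tensor powers commutes with all permutation-invariant matrices. -/
theorem commute_of_commute_tensorPower [CharZero 𝕜] {Φ : Matrix (κ → n) (κ → n) 𝕜}
    (hΦ : ∀ Y : Matrix n n 𝕜, Commute Φ (kroneckerPi fun _ : κ => Y))
    {A : Matrix (κ → n) (κ → n) 𝕜}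
    (hA : ∀ (σ : Equiv.Perm κ) (i j : κ → n), A (i ∘ σ) (j ∘ σ) = A i j) : Commute Φ A := by
  have hsym : ∀ X : κ → Matrix n n 𝕜,
      Commute Φ (∑ σ : Equiv.Perm κ, kroneckerPi fun k => X (σ k)) := by
    intro X
    rw [sum_perm_kroneckerPi]
    exact Commute.sum_right _ _ _ fun U _ => (hΦ _).smul_right _
  -- An invariant matrix is its own average over permutations, hence a combination of symmetrized
  -- matrix units, each a tensor product of matrix units.
  have hA' : (Fintype.card (Equiv.Perm κ) : 𝕜) • A =
      ∑ i : κ → n, ∑ j : κ → n, A i j • ∑ σ : Equiv.Perm κ,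
        kroneckerPi fun k => Matrix.single (i (σ k)) (j (σ k)) (1 : 𝕜) := by
    have h1 : ∀ σ : Equiv.Perm κ, A = ∑ i : κ → n, ∑ j : κ → n, A i j •
        kroneckerPi fun k => Matrix.single (i (σ k)) (j (σ k)) (1 : 𝕜) := by
      intro σ
      conv_lhs => rw [Matrix.matrix_eq_sum_single A]
      rw [← (Equiv.arrowCongr σ.symm (Equiv.refl n)).sum_comp]
      refine Finset.sum_congr rfl fun i _ => ?_
      rw [← (Equiv.arrowCongr σ.symm (Equiv.refl n)).sum_comp]
      refine Finset.sum_congr rfl fun j _ => ?_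
      rw [show (fun k => Matrix.single (i (σ k)) (j (σ k)) (1 : 𝕜)) =
        fun k => Matrix.single ((i ∘ σ) k) ((j ∘ σ) k) (1 : 𝕜) from rfl, kroneckerPi_single]
      have h2 := hA σ i j
      simp only [Matrix.smul_single, smul_eq_mul, mul_one]
      rw [← h2]
      rfl
    calc (Fintype.card (Equiv.Perm κ) : 𝕜) • A = ∑ _σ : Equiv.Perm κ, A := by
          rw [Finset.sum_const, Finset.card_univ, Nat.cast_smul_eq_nsmul]
      _ = _ := Finset.sum_congr rfl fun σ _ => h1 σ
      _ = _ := by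
          rw [Finset.sum_comm]
          refine Finset.sum_congr rfl fun i _ => ?_
          rw [Finset.sum_comm]
          exact Finset.sum_congr rfl fun j _ => Finset.smul_sum.symm
  have h3 : Commute Φ ((Fintype.card (Equiv.Perm κ) : 𝕜) • A) := by
    rw [hA']
    exact Commute.sum_right _ _ _ fun i _ => Commute.sum_right _ _ _ fun j _ =>
      (hsym fun k => Matrix.single (i k) (j k) 1).smul_right _
  have h0 : (Fintype.card (Equiv.Perm κ) : 𝕜) ≠ 0 := Nat.cast_ne_zero.2 Fintype.card_ne_zero
  simpa [smul_smul, inv_mul_cancel₀ h0] using h3.smul_right (Fintype.card (Equiv.Perm κ) : 𝕜)⁻¹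

/-- Schur–Weyl duality: a matrix commuting with all tensor powers is a combination of
permutations. -/
theorem eq_sum_perm_of_commute_tensorPower [CharZero 𝕜] {Φ : Matrix (κ → n) (κ → n) 𝕜}
    (hΦ : ∀ Y : Matrix n n 𝕜, Commute Φ (kroneckerPi fun _ : κ => Y)) :
    ∃ c : Equiv.Perm κ → 𝕜, ∀ (v : (κ → n) → 𝕜) (i : κ → n),
      (Φ.mulVec v) i = ∑ σ, c σ * v (i ∘ σ) := by
  -- A matrix commuting with the permutation action has permutation-invariant entries, as seen on
  -- basis vectors, so Φ commutes with the whole centralizer of that action.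
  have hmem := mem_span_range_of_commute_centralizer (multiIndexRep κ n 𝕜) (Matrix.toLin' Φ) (by
    intro T hT
    obtain ⟨A, rfl⟩ := Matrix.toLin'.surjective T
    have : Commute Φ A := by
      refine commute_of_commute_tensorPower hΦ fun σ i j => ?_
      have h1 := congrFun (congrArg
        (fun S : Module.End 𝕜 ((κ → n) → 𝕜) => S (Pi.single (j ∘ σ) 1)) (hT σ)) i
      have h2 : multiIndexRep κ n 𝕜 σ (Pi.single (j ∘ σ) 1) = Pi.single j 1 := by
        ext i
        rw [multiIndexRep_apply, Pi.single_apply, Pi.single_apply]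
        exact if_congr ⟨fun h => σ.surjective.injective_comp_right h, fun h => h ▸ rfl⟩ rfl rfl
      simpa [h2, multiIndexRep_apply] using h1.symm
    rw [Module.End.mul_eq_comp, Module.End.mul_eq_comp, ← Matrix.toLin'_mul, this.eq,
      Matrix.toLin'_mul])
  rw [Submodule.mem_span_range_iff_exists_fun] at hmem
  obtain ⟨c, hc⟩ := hmem
  refine ⟨c, fun v i => ?_⟩
  have := congrFun (congrArg (fun S : Module.End 𝕜 ((κ → n) → 𝕜) => S v) hc) i
  simpa [multiIndexRep_apply] using this.symm

end SchurWeyl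

end

/-! ### Polynomial density and the Cayley transform. -/

section

section Polynomial

open Polynomial

theorem matrix_map_eval_eq_zero_of_infinite {I R : Type*} [CommRing R] [IsDomain R]
    (M : Matrix I I R[X]) (hM : {z : R | M.map (evalRingHom z) = 0}.Infinite) (z : R) :
    M.map (evalRingHom z) = 0 := by
  ext i j
  have : M i j = 0 := eq_zero_of_infinite_isRoot _ <| hM.mono fun z hz => by
    have := congrFun (congrFun hz i) j
    simpa using this
  simp [this]

theorem infinite_real_eval_ne_zero {p : ℂ[X]} (hp : p ≠ 0) :
    {z : ℂ | (∃ s : ℝ, (s : ℂ) = z) ∧ p.eval z ≠ 0}.Infinite := by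
  have h1 : (Set.range ((↑) : ℝ → ℂ)).Infinite :=
    Set.infinite_range_of_injective Complex.ofReal_injective
  have h2 : {z : ℂ | p.IsRoot z}.Finite := by
    by_contra h
    exact hp (eq_zero_of_infinite_isRoot p h)
  exact h1.sdiff h2

variable {n : Type*}

/-- The affine line `s ↦ A + s B` of matrices. -/
def matrixLine {R : Type*} [CommRing R] (A B : Matrix n n R) : Matrix n n R[X] :=
  A.map C + (X : R[X]) • B.map C

theorem matrixLine_map {R : Type*} [CommRing R] (A B : Matrix n n R) (z : R) :
    (matrixLine A B).map (evalRingHom z) = A + z • B := by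
  ext i j
  simp [matrixLine]
  exact mul_comm _ _

variable [Fintype n] [DecidableEq n]

/-- The determinant is a polynomial in z with value 1 at z = 0, so it has finitely many roots. -/
theorem infinite_real_isUnit (Y : Matrix n n ℂ) :
    {z : ℂ | (∃ s : ℝ, (s : ℂ) = z) ∧ IsUnit (1 + z • Y)}.Infinite := by
  have h : ∀ z, (matrixLine 1 Y).det.eval z = (1 + z • Y).det := fun z => by
    rw [← matrixLine_map, ← coe_evalRingHom, RingHom.map_det]; rfl
  have h0 : (matrixLine 1 Y).det ≠ 0 := fun h' => by
    have := h 0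
    simp [h'] at this
  refine (infinite_real_eval_ne_zero h0).mono fun z hz => ⟨hz.1, ?_⟩
  rw [Matrix.isUnit_iff_isUnit_det, isUnit_iff_ne_zero, ← h]
  exact hz.2

variable {κ : Type*} [Fintype κ] [DecidableEq κ]

/-- The defect of `Φ` in the linearized commutation relation with the Cayley transform of `Y`. -/
def cayleyDefect {R : Type*} [CommRing R] (Φ : Matrix (κ → n) (κ → n) R) (Y : Matrix n n R) :
    Matrix (κ → n) (κ → n) R :=
  kroneckerPi (fun _ => 1 + Y) * Φ * kroneckerPi (fun _ => 1 - Y) -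
    kroneckerPi (fun _ => 1 - Y) * Φ * kroneckerPi (fun _ => 1 + Y)

theorem cayleyDefect_map {R S : Type*} [CommRing R] [CommRing S] (φ : R →+* S)
    (Φ : Matrix (κ → n) (κ → n) R) (Y : Matrix n n R) :
    (cayleyDefect Φ Y).map φ = cayleyDefect (Φ.map φ) (Y.map φ) := by
  have h1 : (1 + Y).map φ = 1 + Y.map φ := by
    rw [Matrix.map_add _ (map_add φ), Matrix.map_one _ (map_zero φ) (map_one φ)]
  have h2 : (1 - Y).map φ = 1 - Y.map φ := by
    rw [Matrix.map_sub _ (map_sub φ), Matrix.map_one _ (map_zero φ) (map_one φ)]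
  rw [cayleyDefect, Matrix.map_sub _ (map_sub φ)]
  simp only [cayleyDefect, Matrix.map_mul, kroneckerPi_map, h1, h2]

/-- The entries of the defect are polynomials in the parameter of the line. This is the density
argument that later removes invertibility conditions and passes from real to complex parameters. -/
theorem cayleyDefect_line_eq_zero {R : Type*} [CommRing R] [IsDomain R]
    {Φ : Matrix (κ → n) (κ → n) R} {A B : Matrix n n R}
    (h : {z : R | cayleyDefect Φ (A + z • B) = 0}.Infinite) (z : R) :
    cayleyDefect Φ (A + z • B) = 0 := by
  have key : ∀ z : R, (cayleyDefect (Φ.map C) (matrixLine A B)).map (evalRingHom z) =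
      cayleyDefect Φ (A + z • B) := fun z => by
    rw [cayleyDefect_map, matrixLine_map]
    congr 1
    ext i j
    simp
  rw [← key]
  refine matrix_map_eval_eq_zero_of_infinite _ ?_ z
  simpa only [key] using h

omit [DecidableEq n] in
theorem commute_tensorPower_line {R : Type*} [CommRing R] [IsDomain R]
    {Φ : Matrix (κ → n) (κ → n) R} {A B : Matrix n n R}
    (h : {z : R | Commute Φ (kroneckerPi fun _ => A + z • B)}.Infinite) (z : R) :
    Commute Φ (kroneckerPi fun _ => A + z • B) := by
  let M := Φ.map C * kroneckerPi (fun _ => matrixLine A B) -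
    kroneckerPi (fun _ => matrixLine A B) * Φ.map C
  have key : ∀ z : R, M.map (evalRingHom z) = Φ * kroneckerPi (fun _ => A + z • B) -
      kroneckerPi (fun _ => A + z • B) * Φ := fun z => by
    have : (Φ.map C).map (evalRingHom z) = Φ := by
      ext i j
      simp
    simp only [M, Matrix.map_sub _ (map_sub (evalRingHom z)), Matrix.map_mul, kroneckerPi_map,
      this, matrixLine_map]
  have := matrix_map_eval_eq_zero_of_infinite M
    (by simp only [key, sub_eq_zero]; exact h) z
  rw [key, sub_eq_zero] at this
  exact this

/-- If `Φ` satisfies all linearized Cayley relations, then it commutes with all tensor powers. -/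
theorem commute_tensorPower_of_cayleyDefect {Φ : Matrix (κ → n) (κ → n) ℂ}
    (h : ∀ Y : Matrix n n ℂ, cayleyDefect Φ Y = 0) (Y : Matrix n n ℂ) :
    Commute Φ (kroneckerPi fun _ => Y) := by
  have unit : ∀ Z : Matrix n n ℂ, IsUnit (1 + Z) → Commute Φ (kroneckerPi fun _ => Z) := by
    intro Z hZ
    obtain ⟨u, hu⟩ := hZ
    -- R is the inverse of 1 + Z, and Y = 1 - 2R inverts the Cayley transform: 1 - Y = 2R has
    -- inverse Q and 1 + Y = 2(1 - R), so Q(1 + Y) = Z. Multiplying the relation for Y by the tensor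
    -- power of Q on both sides leaves commutation with that of Z.
    let R : Matrix n n ℂ := ((u⁻¹ : (Matrix n n ℂ)ˣ) : Matrix n n ℂ)
    let Q : Matrix n n ℂ := (2⁻¹ : ℂ) • (u : Matrix n n ℂ)
    let T := fun Z : Matrix n n ℂ => kroneckerPi fun _ : κ => Z
    have hT : ∀ Z Z', T Z * T Z' = T (Z * Z') := fun _ _ => kroneckerPi_mul _ _
    have hRu : R * u = 1 := u.inv_mul
    have huR : (u : Matrix n n ℂ) * R = 1 := u.mul_inv
    have hs : (2 : ℂ)⁻¹ • (2 : ℂ) • (1 : Matrix n n ℂ) = 1 := by rw [smul_smul]; norm_num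
    have e1 : (1 : Matrix n n ℂ) - (1 - (2 : ℂ) • R) = (2 : ℂ) • R := by abel
    have e2 : Q * ((2 : ℂ) • R) = 1 := by simp [Q, huR, smul_smul]
    have e3 : ((2 : ℂ) • R) * Q = 1 := by simp [Q, hRu, smul_smul]
    have e4 : (1 : Matrix n n ℂ) + (1 - (2 : ℂ) • R) = (2 : ℂ) • (1 - R) := by
      rw [smul_sub, two_smul ℂ (1 : Matrix n n ℂ)]; abel
    have e5 : Q * ((2 : ℂ) • (1 - R)) = Z := by
      simp [Q, mul_sub, huR]
      simp [hu]
    have e6 : ((2 : ℂ) • (1 - R)) * Q = Z := by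
      simp [Q, sub_mul, hRu, smul_smul]
      simp [hu]
    have h0 := h (1 - (2 : ℂ) • R)
    rw [cayleyDefect, sub_eq_zero, e1, e4] at h0
    have hQ : T Q * T ((2 : ℂ) • R) = 1 := by rw [hT, e2]; exact kroneckerPi_one
    have hQ' : T ((2 : ℂ) • R) * T Q = 1 := by rw [hT, e3]; exact kroneckerPi_one
    have h1 : T Q * (T ((2 : ℂ) • (1 - R)) * Φ * T ((2 : ℂ) • R)) * T Q =
      T Q * (T ((2 : ℂ) • R) * Φ * T ((2 : ℂ) • (1 - R))) * T Q := by
        exact congrArg (fun M => T Q * M * T Q) h0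
    have h2 : T Q * (T ((2 : ℂ) • (1 - R)) * Φ * T ((2 : ℂ) • R)) * T Q = T Z * Φ := by
      calc _ = (T Q * T ((2 : ℂ) • (1 - R))) * Φ * (T ((2 : ℂ) • R) * T Q) := by
            simp only [mul_assoc]
        _ = _ := by rw [hQ', hT, e5, mul_one]
    have h3 : T Q * (T ((2 : ℂ) • R) * Φ * T ((2 : ℂ) • (1 - R))) * T Q = Φ * T Z := by
      calc _ = (T Q * T ((2 : ℂ) • R)) * Φ * (T ((2 : ℂ) • (1 - R)) * T Q) := by
            simp only [mul_assoc]
        _ = _ := by rw [hQ, hT, e6, one_mul]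
    exact (h2.symm.trans (h1.trans h3)).symm
  -- On the line z ↦ zY infinitely many points fall under the invertible case; Y is the point z = 1.
  have := commute_tensorPower_line (Φ := Φ) (A := 0) (B := Y)
    ((infinite_real_isUnit Y).mono fun z hz => unit _ (by simpa using hz.2)) 1
  simpa using this

/-- A matrix on multi-indices which is invariant under the unitary group of a nondegenerate
hermitian matrix `H` is a combination of permutations of the tensor power of `H`. -/
theorem eq_sum_perm_of_unitary_invariant {H : Matrix n n ℂ} (hH : H.IsHermitian) (hU : IsUnit H)
    {F : Matrix (κ → n) (κ → n) ℂ}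
    (hF : ∀ D : Matrix n n ℂ, D * H * D.conjTranspose = H →
      kroneckerPi (fun _ => D) * F * kroneckerPi (fun _ => D.conjTranspose) = F) :
    ∃ c : Equiv.Perm κ → ℂ, ∀ i j, F i j = ∑ σ, c σ * ∏ k, H (i (σ k)) (j k) := by
  obtain ⟨u, rfl⟩ := hU
  let T := fun Z : Matrix n n ℂ => kroneckerPi fun _ : κ => Z
  have hT : ∀ Z Z', T Z * T Z' = T (Z * Z') := fun _ _ => kroneckerPi_mul _ _
  have hT1 : T 1 = 1 := kroneckerPi_one
  let K : Matrix n n ℂ := ((u⁻¹ : (Matrix n n ℂ)ˣ) : Matrix n n ℂ)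
  have hKu : K * u = 1 := u.inv_mul
  have huK : (u : Matrix n n ℂ) * K = 1 := u.mul_inv
  -- D H D* = H gives D* = H⁻¹ D⁻¹ H, so invariance of F says that F H⁻¹ commutes with the tensor
  -- power of D.
  let Φ := F * T K
  have hFΦ : F = Φ * T u := by
    rw [mul_assoc, hT, hKu, hT1, mul_one]
  -- For Y skew-adjoint with respect to H, the Cayley transform (1 - Y)⁻¹(1 + Y) preserves H;
  -- clearing denominators in the invariance gives the defect relation.
  have step1 : ∀ Y : Matrix n n ℂ, Y * u = -(u * Y.conjTranspose) → IsUnit (1 - Y) →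
      cayleyDefect Φ Y = 0 := by
    rintro Y hY ⟨w, hw⟩
    let R : Matrix n n ℂ := ((w⁻¹ : (Matrix n n ℂ)ˣ) : Matrix n n ℂ)
    have hRw : R * (1 - Y) = 1 := hw ▸ w.inv_mul
    have hwR : (1 - Y) * R = 1 := hw ▸ w.mul_inv
    have hY' : (u : Matrix n n ℂ) * Y.conjTranspose = - (Y * u) := by rw [hY, neg_neg]
    have c1 : (u : Matrix n n ℂ) * (1 + Y).conjTranspose = (1 - Y) * u := by
      rw [Matrix.conjTranspose_add, Matrix.conjTranspose_one, mul_add, hY']; noncomm_ring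
    have c2 : (u : Matrix n n ℂ) * (1 - Y).conjTranspose = (1 + Y) * u := by
      rw [Matrix.conjTranspose_sub, Matrix.conjTranspose_one, mul_sub, hY']; noncomm_ring
    have hcomm : (1 - Y) * (1 + Y) = (1 + Y) * (1 - Y) := by noncomm_ring
    have hRR : (1 - Y).conjTranspose * R.conjTranspose = 1 := by
      rw [← Matrix.conjTranspose_mul, hRw, Matrix.conjTranspose_one]
    have hD : (R * (1 + Y)) * u * (R * (1 + Y)).conjTranspose = u := by
      calc (R * (1 + Y)) * u * (R * (1 + Y)).conjTranspose
          = R * ((1 + Y) * (u * (1 + Y).conjTranspose)) * R.conjTranspose := by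
            rw [Matrix.conjTranspose_mul]; simp only [mul_assoc]
        _ = R * ((1 - Y) * (u * (1 - Y).conjTranspose)) * R.conjTranspose := by
            rw [c1, c2, ← mul_assoc (1 + Y), ← hcomm, mul_assoc (1 - Y)]
        _ = (R * (1 - Y)) * u * ((1 - Y).conjTranspose * R.conjTranspose) := by
            simp only [mul_assoc]
        _ = u := by rw [hRw, hRR, one_mul, mul_one]
    have h1 := hF _ hD
    change T _ * F * T _ = F at h1
    have h2 : T (1 + Y) * F * T (1 + Y).conjTranspose =
        T (1 - Y) * F * T (1 - Y).conjTranspose := by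
      calc T (1 + Y) * F * T (1 + Y).conjTranspose
          = T (1 - Y) * (T (R * (1 + Y)) * F * T (R * (1 + Y)).conjTranspose) *
              T (1 - Y).conjTranspose := by
            have a1 : T (1 - Y) * T (R * (1 + Y)) = T (1 + Y) := by
              rw [hT, ← mul_assoc, hwR, one_mul]
            have a2 : T (R * (1 + Y)).conjTranspose * T (1 - Y).conjTranspose =
                T (1 + Y).conjTranspose := by
              rw [hT, ← Matrix.conjTranspose_mul, ← mul_assoc, hwR, one_mul]
            rw [← a1, ← a2]
            simp only [mul_assoc]
        _ = _ := by rw [h1]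
    have h3 : T (1 + Y) * Φ * T (1 - Y) * T u = T (1 - Y) * Φ * T (1 + Y) * T u := by
      rw [hFΦ] at h2
      simp only [mul_assoc, hT, c1, c2] at h2 ⊢
      exact h2
    have h4 := congrArg (· * T K) h3
    simp only [mul_assoc, hT, huK, mul_one] at h4
    rw [cayleyDefect, sub_eq_zero]
    simpa only [mul_assoc] using h4
  -- Real multiples of Y stay skew-adjoint, so the invertibility of 1 - Y can be dropped by density.
  have step2 : ∀ Y : Matrix n n ℂ, Y * u = -(u * Y.conjTranspose) → cayleyDefect Φ Y = 0 := by
    intro Y hY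
    have := cayleyDefect_line_eq_zero (Φ := Φ) (A := 0) (B := -Y)
      ((infinite_real_isUnit Y).mono fun z hz => ?_) (-1)
    · simpa using this
    · obtain ⟨⟨s, rfl⟩, hs⟩ := hz
      refine step1 _ ?_ ?_
      · simp [hY]
      · simpa using hs
  have step3 : ∀ Y : Matrix n n ℂ, cayleyDefect Φ Y = 0 := by
    intro Y
    -- With Y† = H Y* H⁻¹, these are A = (Y - Y†)/2 and B = -i(Y + Y†)/2: both are skew-adjoint and
    -- Y = A + iB.
    let A : Matrix n n ℂ := (2⁻¹ : ℂ) • (Y * u - u * Y.conjTranspose) * K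
    let B : Matrix n n ℂ := ((2⁻¹ : ℂ) * (-Complex.I)) • (Y * u + u * Y.conjTranspose) * K
    have hu : (u : Matrix n n ℂ).conjTranspose = u := hH
    have hK : (u : Matrix n n ℂ) * K.conjTranspose = 1 := by
      conv_lhs => rw [← hu]
      rw [← Matrix.conjTranspose_mul, hKu, Matrix.conjTranspose_one]
    have hskew : ∀ S : Matrix n n ℂ, S.conjTranspose = - S →
        (S * K) * u = -(u * (S * K).conjTranspose) := by
      intro S hS
      rw [mul_assoc, hKu, mul_one, Matrix.conjTranspose_mul, ← mul_assoc, hK, one_mul, hS, neg_neg]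
    have hA : A * u = -(u * A.conjTranspose) := hskew _ (by
      simp only [Matrix.conjTranspose_smul, Matrix.conjTranspose_sub, Matrix.conjTranspose_mul,
        Matrix.conjTranspose_conjTranspose, hu]
      rw [← smul_neg, neg_sub]
      simp)
    have hB : B * u = -(u * B.conjTranspose) := hskew _ (by
      simp only [Matrix.conjTranspose_smul, Matrix.conjTranspose_add, Matrix.conjTranspose_mul,
        Matrix.conjTranspose_conjTranspose, hu]
      rw [← neg_smul, add_comm]
      simp)
    have hAB : A + Complex.I • B = Y := by
      have hI : Complex.I * ((2⁻¹ : ℂ) * (-Complex.I)) = 2⁻¹ := by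
        linear_combination (-(2⁻¹ : ℂ)) * Complex.I_mul_I
      simp only [A, B, ← smul_mul_assoc, smul_smul, hI]
      rw [← add_mul, ← smul_add]
      have : Y * u - u * Y.conjTranspose + (Y * u + u * Y.conjTranspose) =
        (2 : ℂ) • (Y * (u : Matrix n n ℂ)) := by rw [two_smul]; abel
      rw [this, smul_smul, inv_mul_cancel₀ two_ne_zero, one_smul, mul_assoc, huK, mul_one]
    rw [← hAB]
    -- A + sB is skew-adjoint for real s, and Y sits at the parameter s = i. The zero matrix serves
    -- only to produce infinitely many reals.
    refine cayleyDefect_line_eq_zero ((infinite_real_isUnit (0 : Matrix n n ℂ)).mono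
      fun z hz => ?_) Complex.I
    obtain ⟨⟨s, rfl⟩, -⟩ := hz
    refine step2 _ ?_
    rw [add_mul, Matrix.conjTranspose_add, mul_add, smul_mul_assoc, hA, hB]
    simp [add_comm]
  obtain ⟨c, hc⟩ := eq_sum_perm_of_commute_tensorPower
    fun Y => commute_tensorPower_of_cayleyDefect step3 Y
  refine ⟨c, fun i j => ?_⟩
  -- Schur–Weyl duality applied to the j-th column of the tensor power of H, since F = Φ · T(H).
  have := hc (fun i => T u i j) i
  rw [hFΦ]
  exact this

end Polynomial

end

/-! ### Matrix coefficients of endomorphisms. -/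

section

variable {V : Type*} [AddCommGroup V] [Module ℂ V]

/-- The functional `v₁ ⊗ ⋯ ⊗ v_r ↦ ∏ B(v_k, w_k)` on the tensor power. -/
def tensorPairing (B : LinearMap.BilinForm ℝ V) {r : ℕ} (w : Fin r → V) :
    RealTensorPower V r →ₗ[ℝ] ℝ :=
  PiTensorProduct.lift
    ((MultilinearMap.mkPiAlgebra ℝ (Fin r) ℝ).compLinearMap fun k => B.flip (w k))

theorem tensorPairing_tprod (B : LinearMap.BilinForm ℝ V) {r : ℕ} (w v : Fin r → V) :
    tensorPairing B w (PiTensorProduct.tprod ℝ v) = ∏ k, B (v k) (w k) := by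
  simp [tensorPairing]

/-- Dual bases resolve the identity of the tensor power as a sum of pairings times basis tensors, so
the pairings separate points. -/
theorem eq_of_tensorPairing_eq {B : LinearMap.BilinForm ℝ V} (hB : B.Nondegenerate)
    {ι : Type*} [Finite ι] (e : Module.Basis ι ℝ V) {r : ℕ}
    {x y : RealTensorPower V r} (h : ∀ w, tensorPairing B w x = tensorPairing B w y) : x = y := by
  classical
  have := Fintype.ofFinite ι
  have hB' : B.flip.Nondegenerate := hB.flip
  let f := B.flip.dualBasis hB' e
  have hf : ∀ i j, B (e i) (f j) = if i = j then 1 else 0 := fun i j =>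
    LinearMap.BilinForm.apply_dualBasis_left hB' e j i
  have key : ∑ a : Fin r → ι, (tensorPairing B fun k => f (a k)).smulRight
      (PiTensorProduct.tprod ℝ fun k => e (a k)) = LinearMap.id := by
    refine PiTensorProduct.ext (MultilinearMap.ext fun v => ?_)
    have hv : ∀ v, v = ∑ a, B v (f a) • e a := fun v => by
      conv_lhs => rw [← e.sum_repr v]
      refine Finset.sum_congr rfl fun a _ => ?_
      congr 1
      conv_rhs => rw [← e.sum_repr v]
      simp only [map_sum, map_smul, LinearMap.sum_apply, LinearMap.smul_apply, hf, smul_eq_mul,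
        mul_ite, mul_one, mul_zero, Finset.sum_ite_eq', Finset.mem_univ, if_true]
    conv_rhs => rw [LinearMap.compMultilinearMap_apply, LinearMap.id_apply, funext fun k => hv (v k),
      MultilinearMap.map_sum]
    simp [tensorPairing_tprod, MultilinearMap.map_smul_univ]
  rw [← LinearMap.id_apply (R := ℝ) x, ← LinearMap.id_apply (R := ℝ) y, ← key]
  simp [h]

variable {h : V →ₗ[ℂ] V →ₗ⋆[ℂ] ℂ} {r : ℕ}

/-- The matrix coefficient `⟨T(v₁ ⊗ ⋯ ⊗ v_r) | w₁ ⊗ ⋯ ⊗ w_r⟩`, as a function of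
the family `(v, w)`. -/
def coeffFun (h : V →ₗ[ℂ] V →ₗ⋆[ℂ] ℂ) (T : Module.End ℝ (RealTensorPower V r))
    (x : Fin r ⊕ Fin r → V) : ℝ :=
  tensorPairing (realForm h) (fun k => x (Sum.inr k))
    (T (PiTensorProduct.tprod ℝ fun k => x (Sum.inl k)))

theorem eq_of_coeffFun_eq (hn : h.Nondegenerate) {ι : Type*} [Finite ι] (e : Module.Basis ι ℝ V)
    {S T : Module.End ℝ (RealTensorPower V r)} (hST : ∀ x, coeffFun h S x = coeffFun h T x) :
    S = T :=
  PiTensorProduct.ext (MultilinearMap.ext fun v =>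
    eq_of_tensorPairing_eq (realForm_nondegenerate hn) e fun w => hST (Sum.elim v w))

theorem coeffFun_one (x : Fin r ⊕ Fin r → V) :
    coeffFun h 1 x = ∏ k, realForm h (x (Sum.inl k)) (x (Sum.inr k)) :=
  tensorPairing_tprod _ _ _

theorem coeffFun_add (S T : Module.End ℝ (RealTensorPower V r)) (x : Fin r ⊕ Fin r → V) :
    coeffFun h (S + T) x = coeffFun h S x + coeffFun h T x := by
  simp [coeffFun]

theorem coeffFun_smul (c : ℝ) (T : Module.End ℝ (RealTensorPower V r)) (x : Fin r ⊕ Fin r → V) :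
    coeffFun h (c • T) x = c * coeffFun h T x := by
  simp [coeffFun]

theorem realForm_symm (hh : IsHermitian h) (v w : V) : realForm h v w = realForm h w v := by
  rw [realForm_apply, hh, Complex.conj_re, realForm_apply]

theorem realForm_I_smul_left (v w : V) :
    realForm h (Complex.I • v) w = -realForm h v (Complex.I • w) := by
  simp [realForm_apply]

/-- Multiplication by i is skew for Re h, whence the sign. -/
theorem tensorPairing_slotJ (l : Fin r) (w : Fin r → V)
    (t : RealTensorPower V r) :
    tensorPairing (realForm h) w (slotJ l t) =
      -tensorPairing (realForm h) (Function.update w l (Complex.I • w l)) t := by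
  suffices tensorPairing (realForm h) w ∘ₗ slotJ l =
      -tensorPairing (realForm h) (Function.update w l (Complex.I • w l)) from
    LinearMap.congr_fun this t
  refine PiTensorProduct.ext (MultilinearMap.ext fun v => ?_)
  simp only [LinearMap.compMultilinearMap_apply, LinearMap.comp_apply, slotJ_tprod,
    LinearMap.neg_apply, tensorPairing_tprod]
  rw [← Finset.mul_prod_erase _ _ (Finset.mem_univ l),
    ← Finset.mul_prod_erase _ _ (Finset.mem_univ l)]
  simp only [Function.update_self, realForm_I_smul_left, neg_mul]
  congr 2
  refine Finset.prod_congr rfl fun k hk => ?_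
  simp [Finset.ne_of_mem_erase hk]

theorem tensorPairing_permMap (σ : Equiv.Perm (Fin r)) (B : LinearMap.BilinForm ℝ V)
    (w : Fin r → V) (t : RealTensorPower V r) :
    tensorPairing B w (permMap σ t) = tensorPairing B (fun k => w (σ.symm k)) t := by
  suffices tensorPairing B w ∘ₗ permMap σ = tensorPairing B (fun k => w (σ.symm k)) from
    LinearMap.congr_fun this t
  refine PiTensorProduct.ext (MultilinearMap.ext fun v => ?_)
  simp only [LinearMap.compMultilinearMap_apply, LinearMap.comp_apply, permMap_tprod,
    tensorPairing_tprod]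
  rw [← Equiv.prod_comp σ fun k => B (v k) (w (σ.symm k))]
  simp

/-- Contracting two slots against a pair of dual bases. -/
theorem sum_realForm_mul_dualBasis (hh : IsHermitian h) (hn : h.Nondegenerate) {ι : Type*}
    [Fintype ι] [DecidableEq ι] (e : Module.Basis ι ℝ V) (w w' : V) :
    ∑ a, realForm h (e a) w *
        realForm h ((realForm h).dualBasis (realForm_nondegenerate hn) e a) w' =
      realForm h w w' := by
  let f := (realForm h).dualBasis (realForm_nondegenerate hn) e
  have hf : ∀ i j, realForm h (f i) (e j) = if j = i then 1 else 0 := fun i j =>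
    LinearMap.BilinForm.apply_dualBasis_left _ e i j
  have hw : w = ∑ a, realForm h (e a) w • f a := by
    conv_lhs => rw [← f.sum_repr w]
    refine Finset.sum_congr rfl fun a _ => ?_
    congr 1
    conv_rhs => rw [← f.sum_repr w]
    simp only [realForm_symm hh (e a), map_sum, map_smul, LinearMap.sum_apply,
      LinearMap.smul_apply, hf, smul_eq_mul, mul_ite, mul_one, mul_zero, Finset.sum_ite_eq,
      Finset.mem_univ, if_true]
  conv_rhs => rw [hw]
  simp [f]

/-- The sum over the dual bases collapses to ⟨w_p | w_q⟩: the contraction is the Brauer diagram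
joining p to q in both rows, whatever the basis. -/
theorem coeffFun_contraction (hh : IsHermitian h) (hn : h.Nondegenerate) {ι : Type*}
    [Fintype ι] [DecidableEq ι] (e : Module.Basis ι ℝ V) {p q : Fin r} (hpq : p ≠ q)
    (x : Fin r ⊕ Fin r → V) :
    coeffFun h (contraction hn e p q hpq) x =
      realForm h (x (Sum.inl p)) (x (Sum.inl q)) * realForm h (x (Sum.inr p)) (x (Sum.inr q)) *
        ∏ k ∈ (Finset.univ.erase p).erase q, realForm h (x (Sum.inl k)) (x (Sum.inr k)) := by
  rw [coeffFun, contraction_tprod, map_smul, map_sum, smul_eq_mul, mul_assoc, realForm_apply,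
    ← sum_realForm_mul_dualBasis hh hn e (x (Sum.inr p)) (x (Sum.inr q)), Finset.sum_mul]
  congr 1
  refine Finset.sum_congr rfl fun a _ => ?_
  rw [tensorPairing_tprod, ← Finset.mul_prod_erase _ _ (Finset.mem_univ p),
    ← Finset.mul_prod_erase _ _ (Finset.mem_erase.2 ⟨hpq.symm, Finset.mem_univ q⟩), mul_assoc]
  simp only [Function.update_self, Function.update_of_ne hpq]
  congr 2
  refine Finset.prod_congr rfl fun k hk => ?_
  have hq := Finset.ne_of_mem_erase hk
  have hp := Finset.ne_of_mem_erase (Finset.mem_of_mem_erase hk)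
  simp [hp, hq]

/-- The matrix coefficient of a composition with a contraction. -/
theorem coeffFun_mul_contraction (hn : h.Nondegenerate) {ι : Type*}
    [Fintype ι] [DecidableEq ι] (e : Module.Basis ι ℝ V) {p q : Fin r} (hpq : p ≠ q)
    (T : Module.End ℝ (RealTensorPower V r)) (x : Fin r ⊕ Fin r → V) :
    coeffFun h (T * contraction hn e p q hpq) x =
      realForm h (x (Sum.inl p)) (x (Sum.inl q)) * ∑ a, coeffFun h T
        (Function.update (Function.update x (Sum.inl p) (e a)) (Sum.inl q)
          ((realForm h).dualBasis (realForm_nondegenerate hn) e a)) := by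
  rw [coeffFun, Module.End.mul_apply, contraction_tprod, map_smul, map_smul, map_sum, map_sum,
    smul_eq_mul, realForm_apply]
  congr 1
  refine Finset.sum_congr rfl fun a _ => ?_
  rw [coeffFun]
  congr 2
  refine congrArg _ (funext fun k => ?_)
  simp only [Function.update_apply, Sum.inl.injEq]

/-! ### Coefficient spans and their closure properties. -/

/-- The complex span of the matrix coefficients of the elements of a real subalgebra. -/
def coeffSpan (h : V →ₗ[ℂ] V →ₗ⋆[ℂ] ℂ)
    (A : Subalgebra ℝ (Module.End ℝ (RealTensorPower V r))) :
    Submodule ℂ ((Fin r ⊕ Fin r → V) → ℂ) :=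
  Submodule.span ℂ {f | ∃ T ∈ A, f = fun x => (coeffFun h T x : ℂ)}

variable {A : Subalgebra ℝ (Module.End ℝ (RealTensorPower V r))}

theorem coeffFun_mem_coeffSpan {T : Module.End ℝ (RealTensorPower V r)} (hT : T ∈ A) :
    (fun x => (coeffFun h T x : ℂ)) ∈ coeffSpan h A :=
  Submodule.subset_span ⟨T, hT, rfl⟩

/-- Separating real and imaginary scalars writes any element of the span as the coefficient of some
S ∈ A plus i times that of some S' ∈ A. A real-valued coefficient therefore equals that of S. -/
theorem mem_of_coeffFun_mem_coeffSpan (hn : h.Nondegenerate) {ι : Type*} [Finite ι]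
    (e : Module.Basis ι ℝ V) {T : Module.End ℝ (RealTensorPower V r)}
    (hT : (fun x => (coeffFun h T x : ℂ)) ∈ coeffSpan h A) : T ∈ A := by
  have key : ∀ f ∈ coeffSpan h A, ∃ S ∈ A, ∃ S' ∈ A,
      ∀ x, f x = coeffFun h S x + coeffFun h S' x * Complex.I := by
    intro f hf
    induction hf using Submodule.span_induction with
    | mem f hf =>
      obtain ⟨T, hT, rfl⟩ := hf
      exact ⟨T, hT, 0, A.zero_mem, fun x => by simp [coeffFun]⟩
    | zero => exact ⟨0, A.zero_mem, 0, A.zero_mem, fun x => by simp [coeffFun]⟩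
    | add f g _ _ hf hg =>
      obtain ⟨S, hS, S', hS', h1⟩ := hf
      obtain ⟨R, hR, R', hR', h2⟩ := hg
      refine ⟨S + R, A.add_mem hS hR, S' + R', A.add_mem hS' hR', fun x => ?_⟩
      rw [Pi.add_apply, h1, h2, coeffFun_add, coeffFun_add]
      push_cast
      ring
    | smul c f _ hf =>
      obtain ⟨S, hS, S', hS', h1⟩ := hf
      refine ⟨c.re • S + (-c.im) • S', A.add_mem (A.smul_mem hS _) (A.smul_mem hS' _),
        c.im • S + c.re • S', A.add_mem (A.smul_mem hS _) (A.smul_mem hS' _), fun x => ?_⟩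
      rw [Pi.smul_apply, h1, smul_eq_mul]
      simp only [coeffFun_add, coeffFun_smul]
      push_cast
      conv_lhs => rw [← Complex.re_add_im c]
      linear_combination (c.im * coeffFun h S' x : ℂ) * Complex.I_mul_I
  obtain ⟨S, hS, S', -, h1⟩ := key _ hT
  suffices T = S from this ▸ hS
  refine eq_of_coeffFun_eq hn e fun x => ?_
  have := congrArg Complex.re (h1 x)
  simpa using this

/-- A linear operator on functions maps the coefficient span to itself, if it does so on
matrix coefficients. -/
theorem coeffSpan_induction (L : ((Fin r ⊕ Fin r → V) → ℂ) →ₗ[ℂ] ((Fin r ⊕ Fin r → V) → ℂ))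
    (hL : ∀ T ∈ A, L (fun x => (coeffFun h T x : ℂ)) ∈ coeffSpan h A)
    {f : (Fin r ⊕ Fin r → V) → ℂ} (hf : f ∈ coeffSpan h A) : L f ∈ coeffSpan h A := by
  have : coeffSpan h A ≤ (coeffSpan h A).comap L := by
    refine Submodule.span_le.2 ?_
    rintro _ ⟨T, hT, rfl⟩
    exact hL T hT
  exact this hf

/-- In an input slot this is right multiplication by `slotJ l`, in an output slot left
multiplication by `-slotJ l`. -/
theorem coeffSpan_update_I (hJ : ∀ l, slotJ l ∈ A) (s : Fin r ⊕ Fin r)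
    {f : (Fin r ⊕ Fin r → V) → ℂ} (hf : f ∈ coeffSpan h A) :
    (fun x => f (Function.update x s (Complex.I • x s))) ∈ coeffSpan h A := by
  refine coeffSpan_induction
    (LinearMap.funLeft ℂ ℂ fun x => Function.update x s (Complex.I • x s)) (fun T hT => ?_) hf
  rcases s with l | l
  · have : (fun x => (coeffFun h (T * slotJ l) x : ℂ)) ∈ coeffSpan h A :=
      coeffFun_mem_coeffSpan (A.mul_mem hT (hJ l))
    convert this using 1
    funext x
    simp only [LinearMap.funLeft_apply, coeffFun, Module.End.mul_apply, slotJ_tprod]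
    congr 4
    funext k
    simp only [Function.update_apply, Sum.inl.injEq]
  · have : (fun x => (coeffFun h (-(slotJ l * T)) x : ℂ)) ∈ coeffSpan h A :=
      coeffFun_mem_coeffSpan (A.neg_mem (A.mul_mem (hJ l) hT))
    convert this using 1
    funext x
    simp only [LinearMap.funLeft_apply, coeffFun, Module.End.mul_apply, LinearMap.neg_apply,
      map_neg, tensorPairing_slotJ, neg_neg]
    congr 3
    · funext k
      simp only [Function.update_apply, Sum.inr.injEq]

/-- Permuting the output slots is left multiplication by a permutation operator. -/
theorem coeffSpan_perm (hρ : ∀ σ, permMap σ ∈ A) (σ : Equiv.Perm (Fin r))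
    {f : (Fin r ⊕ Fin r → V) → ℂ} (hf : f ∈ coeffSpan h A) :
    (fun x => f (x ∘ Sum.map id σ)) ∈ coeffSpan h A := by
  refine coeffSpan_induction (LinearMap.funLeft ℂ ℂ fun x => x ∘ Sum.map id σ) (fun T hT => ?_) hf
  have : (fun x => (coeffFun h (permMap σ.symm * T) x : ℂ)) ∈ coeffSpan h A :=
    coeffFun_mem_coeffSpan (A.mul_mem (hρ _) hT)
  convert this using 1
  funext x
  simp only [LinearMap.funLeft_apply, coeffFun, Module.End.mul_apply, tensorPairing_permMap]
  rfl

/-- Right multiplication by a contraction, seen on coefficients and extended to complex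
combinations. -/
theorem coeffSpan_contraction (hn : h.Nondegenerate) {ι : Type*}
    [Fintype ι] [DecidableEq ι] (e : Module.Basis ι ℝ V) {p q : Fin r} (hpq : p ≠ q)
    (hc : contraction hn e p q hpq ∈ A)
    {f : (Fin r ⊕ Fin r → V) → ℂ} (hf : f ∈ coeffSpan h A) :
    (fun x => (realForm h (x (Sum.inl p)) (x (Sum.inl q)) : ℂ) * ∑ a, f
        (Function.update (Function.update x (Sum.inl p) (e a)) (Sum.inl q)
          ((realForm h).dualBasis (realForm_nondegenerate hn) e a))) ∈ coeffSpan h A := by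
  let L : ((Fin r ⊕ Fin r → V) → ℂ) →ₗ[ℂ] ((Fin r ⊕ Fin r → V) → ℂ) :=
    { toFun := fun f x => (realForm h (x (Sum.inl p)) (x (Sum.inl q)) : ℂ) * ∑ a, f
        (Function.update (Function.update x (Sum.inl p) (e a)) (Sum.inl q)
          ((realForm h).dualBasis (realForm_nondegenerate hn) e a))
      map_add' := fun f g => by
        funext x
        simp [Finset.sum_add_distrib, mul_add]
      map_smul' := fun c f => by
        funext x
        simp only [Pi.smul_apply, smul_eq_mul, ← Finset.mul_sum, RingHom.id_apply]
        ring }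
  refine coeffSpan_induction L (fun T hT => ?_) hf
  have : (fun x => (coeffFun h (T * contraction hn e p q hpq) x : ℂ)) ∈ coeffSpan h A :=
    coeffFun_mem_coeffSpan (A.mul_mem hT hc)
  convert this using 1
  funext x
  simp [L, coeffFun_mul_contraction]

/-- The product of the values of `⟨· | ·⟩` over the pairs of a perfect matching. -/
def matchingFun (h : V →ₗ[ℂ] V →ₗ⋆[ℂ] ℂ) (φ : Equiv.Perm (Fin r ⊕ Fin r))
    (x : Fin r ⊕ Fin r → V) : ℂ :=
  ∏ k, (realForm h (x (φ (Sum.inl k))) (x (φ (Sum.inr k))) : ℂ)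

end

/-! ### Perfect matchings as products of generators. -/

section

variable {V : Type*} [AddCommGroup V] [Module ℂ V] {h : V →ₗ[ℂ] V →ₗ⋆[ℂ] ℂ} {r : ℕ}
  {A : Subalgebra ℝ (Module.End ℝ (RealTensorPower V r))}

/-- The coefficient formula is symmetric in p and q. This is needed because the generators only
include p < q. -/
theorem contraction_symm (hh : IsHermitian h) (hn : h.Nondegenerate) {ι : Type*}
    [Fintype ι] [DecidableEq ι] (e : Module.Basis ι ℝ V) {p q : Fin r} (hpq : p ≠ q) :
    contraction hn e q p hpq.symm = contraction hn e p q hpq :=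
  eq_of_coeffFun_eq hn e fun x => by
    rw [coeffFun_contraction hh, coeffFun_contraction hh, realForm_symm hh (x (Sum.inl q)),
      realForm_symm hh (x (Sum.inr q)), Finset.erase_right_comm]

/-- If a perfect matching on two disjoint rows of equal length meets one row in every pair, then no
pair lies in that row. -/
theorem no_pair_of_forall_exists {X : Type*} (φ : Fin r ⊕ Fin r ≃ X) {ε : Fin r → X}
    (hex : ∀ k, ∃ m, φ (Sum.inl k) = ε m ∨ φ (Sum.inr k) = ε m) (k m m' : Fin r)
    (h1 : φ (Sum.inl k) = ε m) (h2 : φ (Sum.inr k) = ε m') : False := by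
  -- g picks a row element in each pair. It is injective, hence bijective as there are r pairs and r
  -- row elements, so a pair containing two of them would have to pick both.
  choose g hg using hex
  have hinj : Function.Injective g := by
    intro a b hab
    have ha := hg a
    have hb := hg b
    rw [← hab] at hb
    rcases ha with ha | ha <;> rcases hb with hb | hb <;>
      have := φ.injective (ha.trans hb.symm) <;> simp_all
  have hsurj := Finite.surjective_of_injective hinj
  obtain ⟨a, rfl⟩ := hsurj m
  obtain ⟨b, rfl⟩ := hsurj m'
  have ha : a = k := by
    rcases hg a with ha | ha <;> have := φ.injective (ha.trans h1.symm) <;> simp_all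
  have hb : b = k := by
    rcases hg b with hb | hb <;> have := φ.injective (hb.trans h2.symm) <;> simp_all
  subst ha
  subst hb
  have := φ.injective (h1.trans h2.symm)
  simp at this

/-- By counting, no pair lies in the output row either, so every pair joins an input to an output
and the matching is a permutation of the identity diagram. -/
theorem matchingFun_mem_of_no_pair (hh : IsHermitian h) (hρ : ∀ σ, permMap σ ∈ A)
    (φ : Equiv.Perm (Fin r ⊕ Fin r))
    (hφ : ∀ k, ¬∃ m m', φ (Sum.inl k) = Sum.inl m ∧ φ (Sum.inr k) = Sum.inl m') :
    matchingFun h φ ∈ coeffSpan h A := by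
  have hbot : ∀ k, ∃ m, φ (Sum.inl k) = Sum.inr m ∨ φ (Sum.inr k) = Sum.inr m := by
    intro k
    rcases h1 : φ (Sum.inl k) with a | a
    · rcases h2 : φ (Sum.inr k) with b | b
      · exact (hφ k ⟨a, b, h1, h2⟩).elim
      · exact ⟨b, Or.inr rfl⟩
    · exact ⟨a, Or.inl rfl⟩
  have hone : ∀ k, ∃ m m', (φ (Sum.inl k) = Sum.inl m ∧ φ (Sum.inr k) = Sum.inr m') ∨
      (φ (Sum.inl k) = Sum.inr m' ∧ φ (Sum.inr k) = Sum.inl m) := by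
    intro k
    rcases h1 : φ (Sum.inl k) with a | a <;> rcases h2 : φ (Sum.inr k) with b | b
    · exact (hφ k ⟨a, b, h1, h2⟩).elim
    · exact ⟨a, b, Or.inl ⟨rfl, rfl⟩⟩
    · exact ⟨b, a, Or.inr ⟨rfl, rfl⟩⟩
    · exact (no_pair_of_forall_exists φ hbot k a b h1 h2).elim
  choose t b htb using hone
  have ht : Function.Injective t := by
    intro k k' hkk
    have h1 := htb k
    have h2 := htb k'
    rw [← hkk] at h2
    rcases h1 with ⟨h1, -⟩ | ⟨-, h1⟩ <;> rcases h2 with ⟨h2, -⟩ | ⟨-, h2⟩ <;>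
      have := φ.injective (h1.trans h2.symm) <;> simp_all
  have hb : Function.Injective b := by
    intro k k' hkk
    have h1 := htb k
    have h2 := htb k'
    rw [← hkk] at h2
    rcases h1 with ⟨-, h1⟩ | ⟨h1, -⟩ <;> rcases h2 with ⟨-, h2⟩ | ⟨h2, -⟩ <;>
      have := φ.injective (h1.trans h2.symm) <;> simp_all
  let τ := Equiv.ofBijective t (Finite.injective_iff_bijective.1 ht)
  let β := Equiv.ofBijective b (Finite.injective_iff_bijective.1 hb)
  have := coeffSpan_perm (h := h) hρ (τ.symm.trans β) (coeffFun_mem_coeffSpan A.one_mem)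
  convert this using 1
  funext x
  simp only [coeffFun_one, Complex.ofReal_prod, Function.comp_apply, Sum.map_inl, Sum.map_inr, id]
  rw [← Equiv.prod_comp τ]
  refine Finset.prod_congr rfl fun k _ => ?_
  have hk : (τ.symm.trans β) (τ k) = b k := by simp [β]
  rw [hk]
  change _ = (realForm h (x (Sum.inl (t k))) (x (Sum.inr (b k))) : ℂ)
  rcases htb k with ⟨h1, h2⟩ | ⟨h1, h2⟩
  · rw [h1, h2]
  · rw [h1, h2, realForm_symm hh]

/-- Every perfect matching of the `2r` slots lies in the coefficient span. -/
theorem matchingFun_mem (hh : IsHermitian h) (hn : h.Nondegenerate) {ι : Type*}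
    [Fintype ι] [DecidableEq ι] (e : Module.Basis ι ℝ V) (hρ : ∀ σ, permMap σ ∈ A)
    (hc : ∀ p q (hpq : p < q), contraction hn e p q hpq.ne ∈ A)
    (φ : Equiv.Perm (Fin r ⊕ Fin r)) : matchingFun h φ ∈ coeffSpan h A := by
  classical
  -- Induction on the number of pairs that join two inputs.
  induction hN : (Finset.univ.filter fun k => ∃ m m', φ (Sum.inl k) = Sum.inl m ∧
    φ (Sum.inr k) = Sum.inl m').card using Nat.strong_induction_on generalizing φ with
  | _ N ih =>
  by_cases htop : ∃ k, ∃ m m', φ (Sum.inl k) = Sum.inl m ∧ φ (Sum.inr k) = Sum.inl m'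
  swap
  · exact matchingFun_mem_of_no_pair hh hρ φ (not_exists.1 htop)
  obtain ⟨k, p, q, hp, hq⟩ := htop
  -- The rows have equal length, so a pair of inputs forces a pair of outputs.
  have hbot : ∃ k', ∃ p' q', φ (Sum.inl k') = Sum.inr p' ∧ φ (Sum.inr k') = Sum.inr q' := by
    by_contra hcon
    refine no_pair_of_forall_exists φ (ε := Sum.inl) (fun a => ?_) k p q hp hq
    rcases h1 : φ (Sum.inl a) with m | m
    · exact ⟨m, Or.inl rfl⟩
    · rcases h2 : φ (Sum.inr a) with m' | m'
      · exact ⟨m', Or.inr rfl⟩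
      · exact (hcon ⟨a, m, m', h1, h2⟩).elim
  obtain ⟨k', p', q', hp', hq'⟩ := hbot
  have hkk : k ≠ k' := by
    rintro rfl
    rw [hp] at hp'
    cases hp'
  have hpq : p ≠ q := by
    rintro rfl
    have := φ.injective (hp.trans hq.symm)
    simp at this
  have hcpq : contraction hn e p q hpq ∈ A := by
    rcases hpq.lt_or_gt with hlt | hgt
    · exact hc p q hlt
    · rw [← contraction_symm hh]
      exact hc q p hgt
  -- The pairs {p, q} and {p', q'} become {p, p'} and {q, q'}, which lowers the count; contracting p
  -- with q turns the new matching back into the old one.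
  let φ' : Equiv.Perm (Fin r ⊕ Fin r) := φ * Equiv.swap (Sum.inr k) (Sum.inl k')
  have e1 : φ' (Sum.inl k) = Sum.inl p := by
    rw [Equiv.Perm.mul_apply, Equiv.swap_apply_of_ne_of_ne (by simp) (by simpa using hkk), hp]
  have e2 : φ' (Sum.inr k) = Sum.inr p' := by
    rw [Equiv.Perm.mul_apply, Equiv.swap_apply_left, hp']
  have e3 : φ' (Sum.inl k') = Sum.inl q := by
    rw [Equiv.Perm.mul_apply, Equiv.swap_apply_right, hq]
  have e4 : φ' (Sum.inr k') = Sum.inr q' := by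
    rw [Equiv.Perm.mul_apply, Equiv.swap_apply_of_ne_of_ne (by simpa using hkk.symm) (by simp),
      hq']
  have e5 : ∀ a, a ≠ k' → φ' (Sum.inl a) = φ (Sum.inl a) := fun a ha => by
    rw [Equiv.Perm.mul_apply, Equiv.swap_apply_of_ne_of_ne (by simp) (by simpa using ha)]
  have e6 : ∀ a, a ≠ k → φ' (Sum.inr a) = φ (Sum.inr a) := fun a ha => by
    rw [Equiv.Perm.mul_apply, Equiv.swap_apply_of_ne_of_ne (by simpa using ha) (by simp)]
  have hmem : matchingFun h φ' ∈ coeffSpan h A := by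
    refine ih _ ?_ φ' rfl
    rw [← hN]
    refine Finset.card_lt_card (Finset.ssubset_iff_of_subset ?_ |>.2 ⟨k, ?_, ?_⟩)
    · intro a ha
      simp only [Finset.mem_filter, Finset.mem_univ, true_and] at ha ⊢
      obtain ⟨m, m', h1, h2⟩ := ha
      have ha : a ≠ k := by
        rintro rfl
        rw [e2] at h2
        cases h2
      have ha' : a ≠ k' := by
        rintro rfl
        rw [e4] at h2
        cases h2
      exact ⟨m, m', e5 a ha' ▸ h1, e6 a ha ▸ h2⟩
    · simp [hp, hq]
    · simp [e2]
  have := coeffSpan_contraction hn e hpq hcpq hmem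
  convert this using 1
  funext x
  have hsplit : ∀ f : Fin r → ℂ, ∏ a, f a =
      f k * (f k' * ∏ a ∈ (Finset.univ.erase k).erase k', f a) := fun f => by
    rw [Finset.mul_prod_erase _ _ (Finset.mem_erase.2 ⟨hkk.symm, Finset.mem_univ k'⟩),
      Finset.mul_prod_erase _ _ (Finset.mem_univ k)]
  simp only [matchingFun, hsplit, e1, e2, e3, e4, hp, hq, hp', hq']
  have hrest : ∀ a' : ι, ∏ a ∈ (Finset.univ.erase k).erase k',
      (realForm h (Function.update (Function.update x (Sum.inl p) (e a')) (Sum.inl q)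
          ((realForm h).dualBasis (realForm_nondegenerate hn) e a') (φ' (Sum.inl a)))
        (Function.update (Function.update x (Sum.inl p) (e a')) (Sum.inl q)
          ((realForm h).dualBasis (realForm_nondegenerate hn) e a') (φ' (Sum.inr a))) : ℂ) =
      ∏ a ∈ (Finset.univ.erase k).erase k',
        (realForm h (x (φ (Sum.inl a))) (x (φ (Sum.inr a))) : ℂ) := by
    intro a'
    refine Finset.prod_congr rfl fun a ha => ?_
    have hk' := Finset.ne_of_mem_erase ha
    have hk := Finset.ne_of_mem_erase (Finset.mem_of_mem_erase ha)
    have n1 : ∀ s, s ≠ Sum.inl k → φ s ≠ Sum.inl p := fun s hs hs' =>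
      hs (φ.injective (hs'.trans hp.symm))
    have n2 : ∀ s, s ≠ Sum.inr k → φ s ≠ Sum.inl q := fun s hs hs' =>
      hs (φ.injective (hs'.trans hq.symm))
    rw [e5 a hk', e6 a hk, Function.update_of_ne (n2 _ (by simp)),
      Function.update_of_ne (n1 _ (by simpa using hk)),
      Function.update_of_ne (n2 _ (by simpa using hk)), Function.update_of_ne (n1 _ (by simp))]
  simp only [hrest]
  have hne : (Sum.inl p : Fin r ⊕ Fin r) ≠ Sum.inl q := by simpa using hpq
  simp only [Function.update_self, Function.update_of_ne hne, ne_eq, reduceCtorEq,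
    not_false_eq_true, Function.update_of_ne]
  rw [← sum_realForm_mul_dualBasis hh hn e (x (Sum.inr p')) (x (Sum.inr q'))]
  push_cast
  rw [Finset.sum_mul]
  simp only [mul_assoc]

/-- The products of values of `h` over the pairs of a perfect matching lie in the coefficient
span. -/
theorem prod_hermitian_mem (hM : ∀ φ : Equiv.Perm (Fin r ⊕ Fin r), matchingFun h φ ∈ coeffSpan h A)
    (hJ : ∀ l, slotJ l ∈ A) (φ : Equiv.Perm (Fin r ⊕ Fin r)) :
    (fun x : Fin r ⊕ Fin r → V => ∏ k, h (x (φ (Sum.inl k))) (x (φ (Sum.inr k)))) ∈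
      coeffSpan h A := by
  classical
  -- Pairs are upgraded from Re h to h one at a time, by h(v, w) = ⟨v | w⟩ + i⟨v | iw⟩; Z holds the
  -- pairs already done.
  have key : ∀ Z : Finset (Fin r), (fun x : Fin r ⊕ Fin r → V =>
      (∏ k ∈ Z, h (x (φ (Sum.inl k))) (x (φ (Sum.inr k)))) *
        ∏ k ∈ Zᶜ, (realForm h (x (φ (Sum.inl k))) (x (φ (Sum.inr k))) : ℂ)) ∈ coeffSpan h A := by
    intro Z
    induction Z using Finset.induction_on with
    | empty =>
      simp only [Finset.prod_empty, one_mul, Finset.compl_empty]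
      exact hM φ
    | insert a Z ha ih =>
      have h2 := (coeffSpan h A).add_mem ih ((coeffSpan h A).smul_mem Complex.I
        (coeffSpan_update_I hJ (φ (Sum.inr a)) ih))
      convert h2 using 1
      funext x
      have haZ : a ∈ Zᶜ := by simpa using ha
      have hZ : (insert a Z)ᶜ = Zᶜ.erase a := by
        ext b
        simp
      have u1 : ∀ b, Function.update x (φ (Sum.inr a)) (Complex.I • x (φ (Sum.inr a)))
          (φ (Sum.inl b)) = x (φ (Sum.inl b)) := fun b =>
        Function.update_of_ne (fun hb => by simpa using φ.injective hb) _ _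
      have u2 : ∀ b, b ≠ a → Function.update x (φ (Sum.inr a)) (Complex.I • x (φ (Sum.inr a)))
          (φ (Sum.inr b)) = x (φ (Sum.inr b)) := fun b hba =>
        Function.update_of_ne (fun hb => hba (by simpa using φ.injective hb)) _ _
      have hsplit : h (x (φ (Sum.inl a))) (x (φ (Sum.inr a))) =
          (realForm h (x (φ (Sum.inl a))) (x (φ (Sum.inr a))) : ℂ) + Complex.I *
            (realForm h (x (φ (Sum.inl a))) (Complex.I • x (φ (Sum.inr a))) : ℂ) := by
        refine Complex.ext ?_ ?_ <;> simp [realForm_apply]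
      simp only [Pi.add_apply, Pi.smul_apply, smul_eq_mul, hZ]
      rw [Finset.prod_insert ha, ← Finset.mul_prod_erase _ _ haZ, ← Finset.mul_prod_erase _ _ haZ,
        hsplit]
      have p1 : ∏ k ∈ Z, h (Function.update x (φ (Sum.inr a)) (Complex.I • x (φ (Sum.inr a)))
            (φ (Sum.inl k))) (Function.update x (φ (Sum.inr a)) (Complex.I • x (φ (Sum.inr a)))
            (φ (Sum.inr k))) = ∏ k ∈ Z, h (x (φ (Sum.inl k))) (x (φ (Sum.inr k))) :=
        Finset.prod_congr rfl fun b hb => by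
          rw [u1, u2 b fun hba => ha (hba ▸ hb)]
      have p2 : ∏ k ∈ Zᶜ.erase a,
            (realForm h (Function.update x (φ (Sum.inr a)) (Complex.I • x (φ (Sum.inr a)))
            (φ (Sum.inl k))) (Function.update x (φ (Sum.inr a)) (Complex.I • x (φ (Sum.inr a)))
            (φ (Sum.inr k))) : ℂ) =
          ∏ k ∈ Zᶜ.erase a, (realForm h (x (φ (Sum.inl k))) (x (φ (Sum.inr k))) : ℂ) :=
        Finset.prod_congr rfl fun b hb => by
          rw [u1, u2 b (Finset.ne_of_mem_erase hb)]
      rw [p1, p2, u1, Function.update_self]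
      ring
  simpa using key Finset.univ

end

/-! ### Slots of linear and conjugate-linear type. -/

section

variable {V : Type*} [AddCommGroup V] [Module ℂ V]

section Typed

variable {X : Type*} [DecidableEq X]

/-- A real multilinear map is complex linear (`ε = true`) or conjugate linear (`ε = false`)
in the slot `s`. -/
def IsTypedAt (f : MultilinearMap ℝ (fun _ : X => V) ℂ) (s : X) (ε : Bool) : Prop :=
  ∀ x, f (Function.update x s (Complex.I • x s)) = (if ε then Complex.I else -Complex.I) * f x

/-- The identity or the conjugation of `ℂ`. -/
def typedConj (ε : Bool) (c : ℂ) : ℂ := if ε then c else conj c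

theorem IsTypedAt.map_update_smul {f : MultilinearMap ℝ (fun _ : X => V) ℂ} {s : X} {ε : Bool}
    (hf : IsTypedAt f s ε) (x : X → V) (c : ℂ) (v : V) :
    f (Function.update x s (c • v)) = typedConj ε c * f (Function.update x s v) := by
  have h1 : c • v = c.re • v + c.im • (Complex.I • v) := by
    conv_lhs => rw [← Complex.re_add_im c, add_smul, mul_smul, Complex.coe_smul, Complex.coe_smul]
  have h2 := hf (Function.update x s v)
  rw [Function.update_idem, Function.update_self] at h2
  rw [h1, f.map_update_add, f.map_update_smul, f.map_update_smul, h2]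
  cases ε <;> apply Complex.ext <;> (simp [typedConj]; try ring)

theorem map_smul_of_isTypedAt [Fintype X] {f : MultilinearMap ℝ (fun _ : X => V) ℂ} {ε : X → Bool}
    (hf : ∀ s, IsTypedAt f s (ε s)) (c : X → ℂ) (x : X → V) :
    f (fun s => c s • x s) = (∏ s, typedConj (ε s) (c s)) * f x := by
  have key : ∀ Z : Finset X, f (Z.piecewise (fun s => c s • x s) x) =
      (∏ s ∈ Z, typedConj (ε s) (c s)) * f x := by
    intro Z
    induction Z using Finset.induction_on with
    | empty => simp
    | insert a Z ha ih =>
      rw [Finset.piecewise_insert, (hf a).map_update_smul, Finset.prod_insert ha, mul_assoc, ← ih]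
      congr 2
      funext s
      by_cases hs : s = a
      · subst hs
        simp [ha]
      · simp [hs]
  simpa using key Finset.univ

theorem map_sum_of_isTypedAt [Fintype X] {n : Type*} [Fintype n]
    {f : MultilinearMap ℝ (fun _ : X => V) ℂ} {ε : X → Bool}
    (hf : ∀ s, IsTypedAt f s (ε s)) (b : n → V) (c : X → n → ℂ) :
    f (fun s => ∑ i, c s i • b i) =
      ∑ a : X → n, (∏ s, typedConj (ε s) (c s (a s))) * f fun s => b (a s) := by
  rw [f.map_sum]
  exact Finset.sum_congr rfl fun a _ => map_smul_of_isTypedAt hf _ _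

end Typed

/-- An invariant multilinear map of given type in every slot vanishes, unless it has equally many
linear and conjugate linear slots. -/
theorem eq_zero_of_card_ne {X : Type*} [Fintype X] [DecidableEq X] {h : V →ₗ[ℂ] V →ₗ⋆[ℂ] ℂ}
    {f : MultilinearMap ℝ (fun _ : X => V) ℂ} {ε : X → Bool} (hf : ∀ s, IsTypedAt f s (ε s))
    (hU : ∀ g ∈ unitaryGroup h, ∀ x : X → V, f (fun s => g (x s)) = f x)
    (hε : (Finset.univ.filter fun s => ε s = true).card ≠
      (Finset.univ.filter fun s => ¬ε s = true).card) (x : X → V) : f x = 0 := by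
  set p := (Finset.univ.filter fun s => ε s = true).card
  set q := (Finset.univ.filter fun s => ¬ε s = true).card
  have hpq : (p : ℝ) - q ≠ 0 := sub_ne_zero.2 (by exact_mod_cast hε)
  -- The scalar u = exp(iθ) is unitary and multiplies f by u^p ū^q = exp(i(p - q)θ). This angle
  -- makes the factor -1, so f = -f.
  let θ : ℝ := Real.pi / (p - q)
  let u : ℂ := Complex.exp (θ * Complex.I)
  have hu : conj u = Complex.exp (-(θ * Complex.I)) := by
    rw [← Complex.exp_conj]
    simp
  have huu : u * conj u = 1 := by
    rw [hu, ← Complex.exp_add, add_neg_cancel, Complex.exp_zero]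
  have hu0 : u ≠ 0 := Complex.exp_ne_zero _
  let g : V ≃ₗ[ℂ] V := LinearEquiv.smulOfNeZero ℂ V u hu0
  have hg : g ∈ unitaryGroup h := fun v w => by
    simp only [g, LinearEquiv.smulOfNeZero_apply, map_smul, map_smulₛₗ, LinearMap.smul_apply,
      smul_eq_mul]
    linear_combination (h v w) * huu
  have h1 := hU g hg x
  have h2 := map_smul_of_isTypedAt hf (fun _ => u) x
  have h3 : ∏ s, typedConj (ε s) u = -1 := by
    simp only [typedConj, Finset.prod_ite, Finset.prod_const]
    change u ^ p * (conj u) ^ q = -1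
    rw [hu, ← Complex.exp_nat_mul, ← Complex.exp_nat_mul, ← Complex.exp_add, ← Complex.exp_pi_mul_I]
    congr 1
    have : (p - q : ℝ) * θ = Real.pi := mul_div_cancel₀ _ hpq
    have : ((p : ℂ) - q) * θ = Real.pi := by exact_mod_cast this
    linear_combination Complex.I * this
  rw [h3] at h2
  have h4 : f (fun s => g (x s)) = -1 * f x := h2
  rw [h1] at h4
  linear_combination h4 / 2

/-! ### Gram matrices and unitary transformations. -/

section Gram

variable {n : Type*} {h : V →ₗ[ℂ] V →ₗ⋆[ℂ] ℂ}

/-- The Gram matrix of a form. -/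
def gram (h : V →ₗ[ℂ] V →ₗ⋆[ℂ] ℂ) (b : n → V) : Matrix n n ℂ := Matrix.of fun i j => h (b i) (b j)

theorem gram_apply (b : n → V) (i j : n) : gram h b i j = h (b i) (b j) := rfl

theorem gram_isHermitian (hh : IsHermitian h) (b : n → V) : (gram h b).IsHermitian := by
  ext i j
  rw [Matrix.conjTranspose_apply, gram_apply, gram_apply, hh (b i)]
  rfl

variable [Fintype n]

/-- A row vector killed by the Gram matrix is the coordinate vector of an element of the left
radical of h. -/
theorem gram_isUnit [DecidableEq n] (hn : h.Nondegenerate) (b : Module.Basis n ℂ V) :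
    IsUnit (gram h b) := by
  rw [Matrix.isUnit_iff_isUnit_det, isUnit_iff_ne_zero]
  intro hdet
  obtain ⟨v, hv0, hv⟩ := Matrix.exists_vecMul_eq_zero_iff.2 hdet
  have h1 : ∑ i, v i • b i = 0 := by
    refine hn.1 _ fun w => ?_
    suffices h (∑ i, v i • b i) = 0 by rw [this, LinearMap.zero_apply]
    refine b.ext fun j => ?_
    have := congrFun hv j
    simpa [Matrix.vecMul, dotProduct, gram_apply] using this
  exact hv0 (funext (Fintype.linearIndependent_iff.1 b.linearIndependent v h1))

theorem form_sum_sum (b : n → V) (c c' : n → ℂ) :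
    h (∑ i, c i • b i) (∑ j, c' j • b j) = ∑ i, ∑ j, c i * conj (c' j) * gram h b i j := by
  simp only [map_sum, LinearMap.sum_apply, map_smul, LinearMap.smul_apply, map_smulₛₗ, smul_eq_mul,
    gram_apply, Finset.mul_sum]
  rw [Finset.sum_comm]
  exact Finset.sum_congr rfl fun i _ => Finset.sum_congr rfl fun j _ => by ring

/-- A matrix preserving the Gram matrix defines a unitary transformation. -/
theorem exists_unitary_of_gram (hn : h.Nondegenerate) (b : Module.Basis n ℂ V) {D : Matrix n n ℂ}
    (hD : D * gram h b * D.conjTranspose = gram h b) :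
    ∃ g ∈ unitaryGroup h, ∀ i, g (b i) = ∑ j, D i j • b j := by
  let g : V →ₗ[ℂ] V := b.constr ℂ fun i => ∑ j, D i j • b j
  have hgb : ∀ i, g (b i) = ∑ j, D i j • b j := fun i => b.constr_basis ℂ _ i
  have h1 : ∀ i j, h (g (b i)) (g (b j)) = h (b i) (b j) := by
    intro i j
    rw [hgb, hgb, form_sum_sum, ← gram_apply (h := h) b i j]
    conv_rhs => rw [← hD]
    simp only [Matrix.mul_apply, Finset.sum_mul, Matrix.conjTranspose_apply]
    rw [Finset.sum_comm]
    refine Finset.sum_congr rfl fun k _ => Finset.sum_congr rfl fun l _ => ?_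
    rw [Complex.star_def]
    ring
  have h2 : ∀ i w, h (g (b i)) (g w) = h (b i) w := by
    intro i w
    have : (h (g (b i))).comp g = h (b i) := b.ext fun j => h1 i j
    exact LinearMap.congr_fun this w
  have h3 : ∀ v w, h (g v) (g w) = h v w := by
    intro v w
    have : (h.flip (g w)).comp g = h.flip w := b.ext fun i => h2 i w
    exact LinearMap.congr_fun this v
  have hinj : Function.Injective g := by
    rw [← LinearMap.ker_eq_bot, LinearMap.ker_eq_bot']
    intro v hv
    exact hn.1 v fun w => by rw [← h3, hv, map_zero, LinearMap.zero_apply]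
  have := Module.Finite.of_basis b
  exact ⟨LinearEquiv.ofInjectiveEndo g hinj, h3, hgb⟩

end Gram

/-! ### First fundamental theorem for the unitary group. -/

variable {r : ℕ} {h : V →ₗ[ℂ] V →ₗ⋆[ℂ] ℂ}

theorem prod_form_eq_sum {n : Type*} [Fintype n] [DecidableEq n] (b : n → V)
    (c c' : Fin r → n → ℂ) (σ : Equiv.Perm (Fin r)) :
    ∏ k, h (∑ i, c (σ k) i • b i) (∑ j, c' k j • b j) =
      ∑ i : Fin r → n, ∑ j : Fin r → n, (∏ k, c k (i k)) * (∏ k, conj (c' k (j k))) *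
        ∏ k, gram h b (i (σ k)) (j k) := by
  simp only [form_sum_sum]
  rw [Finset.prod_univ_sum, Fintype.piFinset_univ,
    ← (Equiv.arrowCongr σ.symm (Equiv.refl n)).sum_comp]
  refine Finset.sum_congr rfl fun i _ => ?_
  have : ∀ k, (Equiv.arrowCongr σ.symm (Equiv.refl n)) i k = i (σ k) := fun k => rfl
  simp only [this]
  rw [Finset.prod_univ_sum, Fintype.piFinset_univ]
  refine Finset.sum_congr rfl fun j _ => ?_
  rw [Finset.prod_mul_distrib, Finset.prod_mul_distrib, Equiv.prod_comp σ fun k => c k (i k)]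

/-- φ lists the linear slots as its left half and the conjugate-linear ones as its right half, so f
is encoded by a square matrix indexed by pairs of multi-indices. -/
theorem map_sum_matched {n : Type*} [Fintype n]
    {f : MultilinearMap ℝ (fun _ : Fin r ⊕ Fin r => V) ℂ} {ε : Fin r ⊕ Fin r → Bool}
    (hf : ∀ s, IsTypedAt f s (ε s)) {φ : Equiv.Perm (Fin r ⊕ Fin r)}
    (h1 : ∀ k, ε (φ (Sum.inl k)) = true) (h2 : ∀ k, ε (φ (Sum.inr k)) = false)
    (b : n → V) (c : Fin r ⊕ Fin r → n → ℂ) :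
    f (fun s => ∑ i, c s i • b i) = ∑ i : Fin r → n, ∑ j : Fin r → n,
      (∏ k, c (φ (Sum.inl k)) (i k)) * (∏ k, conj (c (φ (Sum.inr k)) (j k))) *
        f fun s => b (Sum.elim i j (φ.symm s)) := by
  rw [map_sum_of_isTypedAt hf, ← Fintype.sum_prod_type' (f := fun i j : Fin r → n =>
      (∏ k, c (φ (Sum.inl k)) (i k)) * (∏ k, conj (c (φ (Sum.inr k)) (j k))) *
        f fun s => b (Sum.elim i j (φ.symm s))),
    ← ((Equiv.sumArrowEquivProdArrow (Fin r) (Fin r) n).symm.trans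
      (Equiv.arrowCongr φ (Equiv.refl n))).sum_comp]
  refine Finset.sum_congr rfl fun ij _ => ?_
  have : ∀ s, ((Equiv.sumArrowEquivProdArrow (Fin r) (Fin r) n).symm.trans
      (Equiv.arrowCongr φ (Equiv.refl n))) ij s = Sum.elim ij.1 ij.2 (φ.symm s) := fun s => rfl
  simp only [this]
  congr 1
  rw [← Equiv.prod_comp φ, Fintype.prod_sum_type]
  simp [h1, h2, typedConj]

/-- In coordinates, invariance of f becomes invariance of its matrix F under all D preserving the
Gram matrix. F is then a combination of permuted tensor powers of the Gram matrix, each of which is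
a product of values of h over a matching. -/
theorem mem_of_isTypedAt_of_card_eq [FiniteDimensional ℂ V] (hh : IsHermitian h)
    (hn : h.Nondegenerate) {S : Submodule ℂ ((Fin r ⊕ Fin r → V) → ℂ)}
    (hS : ∀ φ : Equiv.Perm (Fin r ⊕ Fin r),
      (fun x : Fin r ⊕ Fin r → V => ∏ k, h (x (φ (Sum.inl k))) (x (φ (Sum.inr k)))) ∈ S)
    {f : MultilinearMap ℝ (fun _ : Fin r ⊕ Fin r => V) ℂ} {ε : Fin r ⊕ Fin r → Bool}
    (hf : ∀ s, IsTypedAt f s (ε s))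
    (hU : ∀ g ∈ unitaryGroup h, ∀ x : Fin r ⊕ Fin r → V, f (fun s => g (x s)) = f x)
    {φ : Equiv.Perm (Fin r ⊕ Fin r)}
    (h1 : ∀ k, ε (φ (Sum.inl k)) = true) (h2 : ∀ k, ε (φ (Sum.inr k)) = false) :
    (f : (Fin r ⊕ Fin r → V) → ℂ) ∈ S := by
  let b := Module.finBasis ℂ V
  let F : Matrix (Fin r → Fin (Module.finrank ℂ V)) (Fin r → Fin (Module.finrank ℂ V)) ℂ :=
    Matrix.of fun i j => f fun s => b (Sum.elim i j (φ.symm s))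
  obtain ⟨c, hc⟩ := eq_sum_perm_of_unitary_invariant (gram_isHermitian hh b) (gram_isUnit hn b)
    (F := F) (by
      intro D hD
      obtain ⟨g, hg, hgb⟩ := exists_unitary_of_gram hn b hD
      ext i j
      have h3 := hU g hg fun s => b (Sum.elim i j (φ.symm s))
      simp only [hgb] at h3
      rw [map_sum_matched hf h1 h2 b fun s => D (Sum.elim i j (φ.symm s))] at h3
      refine Eq.trans ?_ h3
      simp only [Matrix.mul_apply, Finset.sum_mul, kroneckerPi_apply, Equiv.symm_apply_apply,
        Sum.elim_inl, Sum.elim_inr, Matrix.conjTranspose_apply]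
      rw [Finset.sum_comm]
      refine Finset.sum_congr rfl fun k _ => Finset.sum_congr rfl fun l _ => ?_
      simp only [F, Matrix.of_apply, Complex.star_def]
      ring)
  have hfx : (f : (Fin r ⊕ Fin r → V) → ℂ) = ∑ σ, c σ • fun x : Fin r ⊕ Fin r → V =>
      ∏ k, h (x (φ (Sum.inl (σ k)))) (x (φ (Sum.inr k))) := by
    funext x
    have h4 := map_sum_matched hf h1 h2 b fun s => b.repr (x s)
    simp only [b.sum_repr] at h4
    rw [h4, Finset.sum_apply]
    have h5 := fun σ : Equiv.Perm (Fin r) => prod_form_eq_sum (h := h) b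
      (fun k => b.repr (x (φ (Sum.inl k)))) (fun k => b.repr (x (φ (Sum.inr k)))) σ
    simp only [b.sum_repr] at h5
    simp only [Pi.smul_apply, h5, smul_eq_mul, Finset.mul_sum]
    conv_rhs => rw [Finset.sum_comm]
    refine Finset.sum_congr rfl fun i _ => ?_
    conv_rhs => rw [Finset.sum_comm]
    refine Finset.sum_congr rfl fun j _ => ?_
    have := hc i j
    simp only [F, Matrix.of_apply] at this
    rw [this, Finset.mul_sum]
    exact Finset.sum_congr rfl fun σ _ => by ring
  rw [hfx]
  refine S.sum_mem fun σ _ => S.smul_mem _ ?_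
  have := hS ((Equiv.sumCongr σ (Equiv.refl _)).trans φ)
  simpa using this

theorem mem_of_isTypedAt [FiniteDimensional ℂ V] (hh : IsHermitian h)
    (hn : h.Nondegenerate) {S : Submodule ℂ ((Fin r ⊕ Fin r → V) → ℂ)}
    (hS : ∀ φ : Equiv.Perm (Fin r ⊕ Fin r),
      (fun x : Fin r ⊕ Fin r → V => ∏ k, h (x (φ (Sum.inl k))) (x (φ (Sum.inr k)))) ∈ S)
    {f : MultilinearMap ℝ (fun _ : Fin r ⊕ Fin r => V) ℂ} {ε : Fin r ⊕ Fin r → Bool}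
    (hf : ∀ s, IsTypedAt f s (ε s))
    (hU : ∀ g ∈ unitaryGroup h, ∀ x : Fin r ⊕ Fin r → V, f (fun s => g (x s)) = f x) :
    (f : (Fin r ⊕ Fin r → V) → ℂ) ∈ S := by
  by_cases hε : (Finset.univ.filter fun s => ε s = true).card =
      (Finset.univ.filter fun s => ¬ε s = true).card
  · have hsum := Finset.card_filter_add_card_filter_not (s := Finset.univ) fun s => ε s = true
    rw [Finset.card_univ, Fintype.card_sum, Fintype.card_fin] at hsum
    have c1 : Fintype.card {s // ε s = true} = r := by
      rw [Fintype.card_subtype]; omega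
    have c2 : Fintype.card {s // ¬ε s = true} = r := by
      rw [Fintype.card_subtype]; omega
    let φ : Equiv.Perm (Fin r ⊕ Fin r) :=
      (Equiv.sumCongr (Fintype.equivFinOfCardEq c1).symm (Fintype.equivFinOfCardEq c2).symm).trans
        (Equiv.sumCompl fun s => ε s = true)
    refine mem_of_isTypedAt_of_card_eq hh hn hS hf hU (φ := φ) (fun k => ?_) (fun k => ?_)
    · exact ((Fintype.equivFinOfCardEq c1).symm k).2
    · exact eq_false_of_ne_true ((Fintype.equivFinOfCardEq c2).symm k).2
  · have : (f : (Fin r ⊕ Fin r → V) → ℂ) = 0 := funext (eq_zero_of_card_ne hf hU hε)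
    rw [this]
    exact S.zero_mem

/-- First fundamental theorem for the unitary group: an invariant real multilinear function is a
combination of products of values of `h` over perfect matchings. -/
theorem mem_of_unitary_invariant [FiniteDimensional ℂ V] (hh : IsHermitian h)
    (hn : h.Nondegenerate) {S : Submodule ℂ ((Fin r ⊕ Fin r → V) → ℂ)}
    (hS : ∀ φ : Equiv.Perm (Fin r ⊕ Fin r),
      (fun x : Fin r ⊕ Fin r → V => ∏ k, h (x (φ (Sum.inl k))) (x (φ (Sum.inr k)))) ∈ S)
    (f : MultilinearMap ℝ (fun _ : Fin r ⊕ Fin r => V) ℂ)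
    (hU : ∀ g ∈ unitaryGroup h, ∀ x : Fin r ⊕ Fin r → V, f (fun s => g (x s)) = f x) :
    (f : (Fin r ⊕ Fin r → V) → ℂ) ∈ S := by
  -- Z contains the slots that may still lack a type; they are split one by one.
  have key : ∀ Z : Finset (Fin r ⊕ Fin r), ∀ f : MultilinearMap ℝ (fun _ : Fin r ⊕ Fin r => V) ℂ,
      (∀ g ∈ unitaryGroup h, ∀ x : Fin r ⊕ Fin r → V, f (fun s => g (x s)) = f x) →
      (∀ s ∉ Z, ∃ ε, IsTypedAt f s ε) → (f : (Fin r ⊕ Fin r → V) → ℂ) ∈ S := by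
    intro Z
    induction Z using Finset.induction_on with
    | empty =>
      intro f hU hf
      choose ε hε using fun s => hf s (Finset.notMem_empty s)
      exact mem_of_isTypedAt hh hn hS hε hU
    | insert a Z ha ih =>
      intro f hU hf
      let f' : MultilinearMap ℝ (fun _ : Fin r ⊕ Fin r => V) ℂ :=
        f.compLinearMap fun s => if s = a then J else LinearMap.id
      have hf' : ∀ x, f' x = f (Function.update x a (Complex.I • x a)) := by
        intro x
        rw [MultilinearMap.compLinearMap_apply]
        congr 1
        funext s
        by_cases hs : s = a
        · subst hs
          simp [J]
        · simp [hs]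
      -- For c = -i this is the part of f linear in slot a, for c = i the conjugate-linear part.
      let P : ℂ → MultilinearMap ℝ (fun _ : Fin r ⊕ Fin r => V) ℂ :=
        fun c => (2⁻¹ : ℂ) • (f + c • f')
      have hP : ∀ c x, P c x = 2⁻¹ * (f x + c * f (Function.update x a (Complex.I • x a))) := by
        intro c x
        rw [← hf']
        rfl
      have hPU : ∀ c, ∀ g ∈ unitaryGroup h, ∀ x : Fin r ⊕ Fin r → V,
          P c (fun s => g (x s)) = P c x := by
        intro c g hg x
        rw [hP, hP, hU g hg, ← hU g hg (Function.update x a (Complex.I • x a))]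
        congr 4
        funext s
        by_cases hs : s = a
        · subst hs
          simp
        · simp [hs]
      have hPt : ∀ c, (c = -Complex.I ∨ c = Complex.I) → ∀ s ∉ Z, ∃ ε, IsTypedAt (P c) s ε := by
        intro c hc s hs
        by_cases hsa : s = a
        · subst hsa
          have hneg : ∀ x : Fin r ⊕ Fin r → V,
              f (Function.update x s (Complex.I • Complex.I • x s)) = - f x := by
            intro x
            rw [smul_smul, Complex.I_mul_I, ← Complex.ofReal_one, ← Complex.ofReal_neg,
              Complex.coe_smul, f.map_update_smul, Function.update_eq_self]
            simp
          rcases hc with rfl | rfl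
          · refine ⟨true, fun x => ?_⟩
            rw [hP, hP, Function.update_idem, Function.update_self, hneg, if_pos rfl]
            linear_combination (2⁻¹ * f (Function.update x s (Complex.I • x s))) * Complex.I_mul_I
          · refine ⟨false, fun x => ?_⟩
            rw [hP, hP, Function.update_idem, Function.update_self, hneg, if_neg (by simp)]
            linear_combination (2⁻¹ * f (Function.update x s (Complex.I • x s))) * Complex.I_mul_I
        · obtain ⟨ε, hε⟩ := hf s (by simp [hsa, hs])
          refine ⟨ε, fun x => ?_⟩
          have h1 := hε (Function.update x a (Complex.I • x a))
          rw [Function.update_of_ne hsa, Function.update_comm (Ne.symm hsa)] at h1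
          rw [hP, hP, hε, Function.update_of_ne (Ne.symm hsa), h1]
          ring
      have hsum : (f : (Fin r ⊕ Fin r → V) → ℂ) = P (-Complex.I) + P Complex.I := by
        funext x
        rw [Pi.add_apply, hP, hP]
        ring
      rw [hsum]
      exact S.add_mem (ih _ (hPU _) (hPt _ (Or.inl rfl))) (ih _ (hPU _) (hPt _ (Or.inr rfl)))
  exact key Finset.univ f hU fun s hs => (hs (Finset.mem_univ s)).elim

/-! ### Centralizer elements as invariant multilinear functions. -/

theorem tensorPairing_update_add (B : LinearMap.BilinForm ℝ V) (w : Fin r → V) (l : Fin r)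
    (a b : V) : tensorPairing B (Function.update w l (a + b)) =
      tensorPairing B (Function.update w l a) + tensorPairing B (Function.update w l b) := by
  refine PiTensorProduct.ext (MultilinearMap.ext fun v => ?_)
  simp only [LinearMap.compMultilinearMap_apply, LinearMap.add_apply, tensorPairing_tprod]
  exact ((MultilinearMap.mkPiAlgebra ℝ (Fin r) ℝ).compLinearMap
    fun k => B (v k)).map_update_add w l a b

theorem tensorPairing_update_smul (B : LinearMap.BilinForm ℝ V) (w : Fin r → V) (l : Fin r)
    (c : ℝ) (a : V) : tensorPairing B (Function.update w l (c • a)) =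
      c • tensorPairing B (Function.update w l a) := by
  refine PiTensorProduct.ext (MultilinearMap.ext fun v => ?_)
  simp only [LinearMap.compMultilinearMap_apply, LinearMap.smul_apply, tensorPairing_tprod]
  exact ((MultilinearMap.mkPiAlgebra ℝ (Fin r) ℝ).compLinearMap
    fun k => B (v k)).map_update_smul w l c a

theorem coeffFun_update_inl (T : Module.End ℝ (RealTensorPower V r)) (x : Fin r ⊕ Fin r → V)
    (l : Fin r) (a : V) : coeffFun h T (Function.update x (Sum.inl l) a) =
      tensorPairing (realForm h) (fun k => x (Sum.inr k))
        (T (PiTensorProduct.tprod ℝ (Function.update (fun k => x (Sum.inl k)) l a))) := by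
  simp only [coeffFun, Function.update_apply, Sum.inl.injEq, reduceCtorEq, if_false]
  congr 3
  funext k
  rw [Function.update_apply]

theorem coeffFun_update_inr (T : Module.End ℝ (RealTensorPower V r)) (x : Fin r ⊕ Fin r → V)
    (l : Fin r) (a : V) : coeffFun h T (Function.update x (Sum.inr l) a) =
      tensorPairing (realForm h) (Function.update (fun k => x (Sum.inr k)) l a)
        (T (PiTensorProduct.tprod ℝ fun k => x (Sum.inl k))) := by
  simp only [coeffFun, Function.update_apply, Sum.inr.injEq, reduceCtorEq, if_false]
  congr 2
  funext k
  rw [Function.update_apply]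

/-- The matrix coefficient function as a multilinear map. -/
def coeffMultilinear (h : V →ₗ[ℂ] V →ₗ⋆[ℂ] ℂ) (T : Module.End ℝ (RealTensorPower V r)) :
    MultilinearMap ℝ (fun _ : Fin r ⊕ Fin r => V) ℂ :=
  MultilinearMap.mk' (fun x => (coeffFun h T x : ℂ))
    (by
      rintro x (l | l) a b
      · simp only [coeffFun_update_inl, MultilinearMap.map_update_add, map_add, Complex.ofReal_add]
      · simp only [coeffFun_update_inr, tensorPairing_update_add, LinearMap.add_apply,
          Complex.ofReal_add])
    (by
      rintro x (l | l) c a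
      · simp only [coeffFun_update_inl, MultilinearMap.map_update_smul, map_smul, smul_eq_mul,
          Complex.ofReal_mul, Complex.real_smul]
      · simp only [coeffFun_update_inr, tensorPairing_update_smul, LinearMap.smul_apply,
          smul_eq_mul, Complex.ofReal_mul, Complex.real_smul])

theorem tensorPairing_diagonalAction {g : V ≃ₗ[ℂ] V} (hg : g ∈ unitaryGroup h) (w : Fin r → V)
    (t : RealTensorPower V r) :
    tensorPairing (realForm h) (fun k => g (w k)) (diagonalAction r g t) =
      tensorPairing (realForm h) w t := by
  suffices tensorPairing (realForm h) (fun k => g (w k)) ∘ₗ diagonalAction r g =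
      tensorPairing (realForm h) w from LinearMap.congr_fun this t
  refine PiTensorProduct.ext (MultilinearMap.ext fun v => ?_)
  simp only [LinearMap.compMultilinearMap_apply, LinearMap.comp_apply, diagonalAction,
    PiTensorProduct.map_tprod, tensorPairing_tprod, realForm_apply]
  exact Finset.prod_congr rfl fun k _ => congrArg Complex.re (hg _ _)

/-- Elements of the group preserve the pairing, so an action on the output of T can be moved to the
vectors it is paired with. -/
theorem mem_centralizerAlgebra_iff (hn : h.Nondegenerate) {ι : Type*} [Finite ι]
    (e : Module.Basis ι ℝ V) {T : Module.End ℝ (RealTensorPower V r)} :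
    T ∈ centralizerAlgebra h r ↔
      ∀ g ∈ unitaryGroup h, ∀ x, coeffFun h T (fun s => g (x s)) = coeffFun h T x := by
  have hd : ∀ (g : V ≃ₗ[ℂ] V) (v : Fin r → V), diagonalAction r g (PiTensorProduct.tprod ℝ v) =
      PiTensorProduct.tprod ℝ fun k => g (v k) := fun g v => PiTensorProduct.map_tprod _ _
  rw [centralizerAlgebra, Subalgebra.mem_centralizer_iff]
  constructor
  · intro hT g hg x
    have h1 := LinearMap.congr_fun (hT _ ⟨g, hg, rfl⟩)
      (PiTensorProduct.tprod ℝ fun k => x (Sum.inl k))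
    rw [Module.End.mul_apply, Module.End.mul_apply, hd] at h1
    rw [coeffFun, ← h1, tensorPairing_diagonalAction hg, coeffFun]
  · rintro hT _ ⟨g, hg, rfl⟩
    refine eq_of_coeffFun_eq hn e fun x => ?_
    -- Invariance is used with g⁻¹ applied to the output vectors, so that g acts on the inputs
    -- alone.
    let y : Fin r ⊕ Fin r → V := Sum.elim (fun k => x (Sum.inl k)) fun k => g.symm (x (Sum.inr k))
    have hw : (fun k => x (Sum.inr k)) = fun k => g (g.symm (x (Sum.inr k))) := by simp
    have h1 := hT g hg y
    rw [coeffFun, coeffFun, Module.End.mul_apply, Module.End.mul_apply, hd]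
    conv_lhs => rw [hw]
    rw [tensorPairing_diagonalAction hg]
    simpa [coeffFun, y] using h1.symm

theorem permMap_mem_centralizerAlgebra (hn : h.Nondegenerate) {ι : Type*} [Finite ι]
    (e : Module.Basis ι ℝ V) (σ : Equiv.Perm (Fin r)) :
    permMap σ ∈ centralizerAlgebra h r := by
  rw [mem_centralizerAlgebra_iff hn e]
  intro g hg x
  rw [coeffFun, coeffFun, permMap_tprod, permMap_tprod, tensorPairing_tprod, tensorPairing_tprod]
  exact Finset.prod_congr rfl fun k _ => congrArg Complex.re (hg _ _)

theorem slotJ_mem_centralizerAlgebra (hn : h.Nondegenerate) {ι : Type*} [Finite ι]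
    (e : Module.Basis ι ℝ V) (l : Fin r) :
    slotJ l ∈ centralizerAlgebra h r := by
  rw [mem_centralizerAlgebra_iff hn e]
  intro g hg x
  have : Function.update (fun k => g (x (Sum.inl k))) l (Complex.I • g (x (Sum.inl l))) =
      fun k => g (Function.update (fun k => x (Sum.inl k)) l (Complex.I • x (Sum.inl l)) k) := by
    rw [← map_smul]
    exact (Function.comp_update g _ _ _).symm
  rw [coeffFun, coeffFun, slotJ_tprod, slotJ_tprod, this, tensorPairing_tprod, tensorPairing_tprod]
  exact Finset.prod_congr rfl fun k _ => congrArg Complex.re (hg _ _)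

theorem contraction_mem_centralizerAlgebra (hh : IsHermitian h) (hn : h.Nondegenerate) {ι : Type*}
    [Fintype ι] [DecidableEq ι] (e : Module.Basis ι ℝ V) {p q : Fin r} (hpq : p ≠ q) :
    contraction hn e p q hpq ∈ centralizerAlgebra h r := by
  rw [mem_centralizerAlgebra_iff hn e]
  intro g hg x
  have hB : ∀ v w, realForm h (g v) (g w) = realForm h v w := fun v w => congrArg Complex.re (hg v w)
  rw [coeffFun_contraction hh, coeffFun_contraction hh]
  simp only [hB]

end

end UnitaryTensor

end

/-! ### The generation theorem. -/

theorem theorem3p1 {V : Type*} [AddCommGroup V] [Module ℂ V] [FiniteDimensional ℂ V]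
    (h : V →ₗ[ℂ] V →ₗ⋆[ℂ] ℂ) (hh : UnitaryTensor.IsHermitian h) (hn : h.Nondegenerate)
    {ι : Type*} [Fintype ι] [DecidableEq ι] (e : Module.Basis ι ℝ V) (r : ℕ) :
    UnitaryTensor.centralizerAlgebra h r =
      Algebra.adjoin ℝ
        (Set.range (fun σ : Equiv.Perm (Fin r) => UnitaryTensor.permMap (V := V) σ) ∪
          Set.range (fun l : Fin r => UnitaryTensor.slotJ (V := V) l) ∪
          {T | ∃ (p q : Fin r) (hpq : p < q), T = UnitaryTensor.contraction hn e p q hpq.ne}) := by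
  apply le_antisymm
  · intro T hT
    refine UnitaryTensor.mem_of_coeffFun_mem_coeffSpan hn e ?_
    refine UnitaryTensor.mem_of_unitary_invariant hh hn (fun φ => ?_)
      (UnitaryTensor.coeffMultilinear h T) fun g hg x => congrArg Complex.ofReal
        ((UnitaryTensor.mem_centralizerAlgebra_iff hn e).1 hT g hg x)
    refine UnitaryTensor.prod_hermitian_mem (UnitaryTensor.matchingFun_mem hh hn e
      (fun σ => Algebra.subset_adjoin (Or.inl (Or.inl ⟨σ, rfl⟩)))
      fun p q hpq => Algebra.subset_adjoin (Or.inr ⟨p, q, hpq, rfl⟩))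
      (fun l => Algebra.subset_adjoin (Or.inl (Or.inr ⟨l, rfl⟩))) φ
  · refine Algebra.adjoin_le ?_
    rintro _ ((⟨σ, rfl⟩ | ⟨l, rfl⟩) | ⟨p, q, hpq, rfl⟩)
    · exact UnitaryTensor.permMap_mem_centralizerAlgebra hn e σ
    · exact UnitaryTensor.slotJ_mem_centralizerAlgebra hn e l
    · exact UnitaryTensor.contraction_mem_centralizerAlgebra hh hn e hpq.ne
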